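/- **Setting.** Let $k\ge 1$. A mechanism is a triple $(Z,\mathbf P,\mathbf Q)$: $Z$ is any measurable space of signals; $\mathbf P=(P_u)_{u\in\mathbb R}$ assigns to each user $u\in\mathbb R$ a probability distribution $P_u$ on $Z$; $\mathbf Q=(Q_s)_{s\in Z}$ assigns (measurably in $s$) to each signal a probability distribution $Q_s$ on $\mathbb R^k$. Let $\mathfrak h$ be a continuous increasing function on $[0,\infty)$ with $\mathfrak h(0)=0$ such that, for some $B>0$, $\log\mathfrak h$ is finite and Lipschitz on $[B,\infty)$. The cost of a mechanism is $$\mathrm{cost}^{\mathfrak h}(Z,\mathbf P,\mathbf Q)=\sup_{u\in\mathbb R}\ \mathbb E_{s\sim P_u}\,\mathbb E_{a\sim Q_s}\Big[\min_{1\le i\le k}\mathfrak h(|u-a_i|)\Big]\in[0,\infty].$$ Let $\mathfrak g:[0,\infty)\to[0,\infty]$ be increasing and convex with $\mathfrak g(0)=0$, (right-)differentiable at $0$ with finite derivative $\mathfrak g'(0)\ne 0$ (so $\mathfrak g'(0)>0$). $\mathbf P$ is $\mathfrak g$-geographically differentially private if $P_{u_1}(S)\le e^{\mathfrak g(|u_1-u_2|)}P_{u_2}(S)$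 for all $u_1,u_2\in\mathbb R$ and all measurable $S\subseteq Z$ (no condition on the pair $u_1,u_2$ if $\mathfrak g(|u_1-u_2|)=\infty$). Let $f^{\mathfrak h}(\mathfrak g,k)$ be the infimum of $\mathrm{cost}^{\mathfrak h}(Z,\mathbf P,\mathbf Q)$ over all mechanisms whose $\mathbf P$ is $\mathfrak g$-geographically differentially private. **Theorem.** 1. For all such $\mathfrak h,\mathfrak g,k$, adding Laplace noise is an optimal user action: let $Z=\mathbb R$ and let $P^*_u$ be the law of $u+X$, where $X$ has density $\rho(x)=\frac{\mathfrak g'(0)}2e^{-\mathfrak g'(0)|x|}$. Then $\mathbf P^*$ is $\mathfrak g$-geographically differentially private, and there is a server action $\mathbf Q$ with $\mathrm{cost}^{\mathfrak h}(\mathbb R,\mathbf P^*,\mathbf Q)=f^{\mathfrak h}(\mathfrak g,k)$. 2. For $\mathfrak h(z)=z$ we have $f^{\mathfrak h}(\mathfrak g,k)=O\big(\frac1{\mathfrak g'(0)\,k}\big)$: there is an absolute constant $C$ such that $f^{\mathfrak h}(\mathfrak g,k)\le \frac{C}{\mathfrak g'(0)\,k}$ for all $\mathfrak g$ as above and all $k\ge1$.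 3. For $\mathfrak h(z)=z$ an optimal mechanism is given in closed form: the users play $\mathbf P^*$, and the server answers a signal $s$ deterministically by $(s+x_1,\dots,s+x_k)$, where $x_{k+1-i}=-x_i$ for all $i$ and, for $1\le i\le (k+1)/2$, $$x_i=-\frac{2}{\mathfrak g'(0)}\log\frac{t+1}{i}\ \text{ if } k=2t+1,\qquad x_i=-\frac{1}{\mathfrak g'(0)}\log\frac{t(t+1)}{i^2}\ \text{ if } k=2t.$$ The cost of this mechanism equals $f^{\mathfrak h}(\mathfrak g,k)$. -/

import Mathlib

open MeasureTheory ProbabilityTheory Filter Topology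
open scoped NNReal ENNReal

universe v

/-- Admissible disutility functions `h` on `[0, ∞)`: continuous, increasing, `h 0 = 0`, and
`log h` is (well defined and) Lipschitz on some half-line `[B, ∞)` with `B > 0`. -/
structure IsDisutility (h : ℝ → ℝ) : Prop where
  continuousOn : ContinuousOn h (Set.Ici 0)
  monotoneOn : MonotoneOn h (Set.Ici 0)
  map_zero : h 0 = 0
  log_lipschitz : ∃ B : ℝ, 0 < B ∧ (∀ z, B ≤ z → 0 < h z) ∧
    ∃ K : ℝ≥0, LipschitzOnWith K (fun z => Real.log (h z)) (Set.Ici B)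

/-- `g : [0, ∞) → [0, ∞]` is an admissible privacy profile with (right) derivative `ε` at `0`:
it is increasing and convex, `g 0 = 0`, and it is differentiable at `0` with `g'(0) = ε ≠ 0`.
The value `∞` is allowed. Since `g 0 = 0`, the difference quotient at `0` is `g t / t`; it is
nonnegative, so `ε ≠ 0` means `0 < ε`. -/
structure IsPrivacyProfile (g : ℝ≥0 → ℝ≥0∞) (ε : ℝ) : Prop where
  monotone : Monotone g
  convex : ConvexOn ℝ≥0 Set.univ g
  map_zero : g 0 = 0
  deriv_zero : Tendsto (fun t : ℝ≥0 => g t / (t : ℝ≥0∞)) (𝓝[≠] 0) (𝓝 (ENNReal.ofReal ε))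
  deriv_pos : 0 < ε

/-- `P` is an action of the users with signal space `Z` (a probability distribution `P u` of
signals for each user `u`) which is `g`-geographically differentially private:
`P u₁ (S) ≤ exp (g |u₁ - u₂|) * P u₂ (S)`. There is no constraint on the pair `u₁, u₂` when
`g |u₁ - u₂| = ∞`. -/
structure IsGeoPrivate (g : ℝ≥0 → ℝ≥0∞) {Z : Type v} [MeasurableSpace Z]
    (P : ℝ → Measure Z) : Prop where
  isProbabilityMeasure : ∀ u, IsProbabilityMeasure (P u)
  le_exp_mul : ∀ u₁ u₂ : ℝ, g (nndist u₁ u₂) ≠ ∞ → ∀ S : Set Z, MeasurableSet S →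
    P u₁ S ≤ ENNReal.ofReal (Real.exp (g (nndist u₁ u₂)).toReal) * P u₂ S

/-- Disutility of user `u` from the results `a₁, …, a_k`: the minimum of `h |u - a_i|`. -/
noncomputable def minDisutility (h : ℝ → ℝ) {k : ℕ} (u : ℝ) (a : Fin k → ℝ) : ℝ≥0∞ :=
  ⨅ i, ENNReal.ofReal (h |u - a i|)

/-- Worst-case expected disutility of the mechanism `(Z, P, Q)`: user `u` draws a signal `s` from
`P u`, and the server, on receiving `s`, draws its `k` results from `Q s`. -/
noncomputable def mechanismCost (h : ℝ → ℝ) {k : ℕ} {Z : Type v} [MeasurableSpace Z]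
    (P : ℝ → Measure Z) (Q : Kernel Z (Fin k → ℝ)) : ℝ≥0∞ :=
  ⨆ u : ℝ, ∫⁻ s, ∫⁻ a, minDisutility h u a ∂(Q s) ∂(P u)

/-- The optimal cost: the infimum of the cost over all signal spaces `Z`, all private user
actions `P` and all server actions `Q`. -/
noncomputable def optimalCost (h : ℝ → ℝ) (g : ℝ≥0 → ℝ≥0∞) (k : ℕ) : ℝ≥0∞ :=
  ⨅ (Z : Type v) (_ : MeasurableSpace Z) (P : ℝ → Measure Z) (_ : IsGeoPrivate g P)
    (Q : Kernel Z (Fin k → ℝ)) (_ : IsMarkovKernel Q), mechanismCost h P Q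

/-- Laplace noise of rate `ε`, with density `(ε / 2) * exp (-ε |x|)`. -/
noncomputable def laplaceNoise (ε : ℝ) : Measure ℝ :=
  volume.withDensity fun x => ENNReal.ofReal (ε / 2 * Real.exp (-ε * |x|))

/-- The user action of adding Laplace noise: user `u` sends `u + x` with `x` Laplace noise. -/
noncomputable def laplaceAction (ε : ℝ) (u : ℝ) : Measure ℝ :=
  (laplaceNoise ε).map fun x => u + x

/-- The server action which answers the signal `s` by `s + a₁, …, s + a_k`. -/
noncomputable def shiftResponse {k : ℕ} (a : Fin k → ℝ) : Kernel ℝ (Fin k → ℝ) :=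
  Kernel.deterministic (fun s i => s + a i)
    (measurable_pi_lambda _ fun i => measurable_id.add_const (a i))

/-- Distance from `0` of the `j`-th outermost closed-form point on either side,
`1 ≤ j ≤ (k + 1) / 2`. For odd `k = 2t + 1` it is `(2 / ε) * log ((t + 1) / j)` and for even
`k = 2t` it is `(1 / ε) * log (t (t + 1) / j ^ 2)`. -/
noncomputable def closedFormRadius (k : ℕ) (ε : ℝ) (j : ℕ) : ℝ :=
  if Odd k then 2 * Real.log ((((k : ℝ) + 1) / 2) / j) / ε
  else Real.log (((k : ℝ) / 2) * ((k : ℝ) / 2 + 1) / (j : ℝ) ^ 2) / ε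

/-- The closed-form points `x₁ ≤ … ≤ x_k`, symmetric about `0`; `i : Fin k` stands for the index
`i + 1`. -/
noncomputable def closedFormPoint (k : ℕ) (ε : ℝ) (i : Fin k) : ℝ :=
  if 2 * ((i : ℕ) + 1) ≤ k + 1 then -closedFormRadius k ε ((i : ℕ) + 1)
  else closedFormRadius k ε (k - (i : ℕ))

/-! Write `ε` for `g'(0)`. Everything reduces to one number, the least `laplaceCost h ε a` over
lists `a`: the least expected disutility of fixed answers when the user's position is Laplace of
rate `ε`.

Upper bound: convexity gives `ε t ≤ g t`, so Laplace noise is private, and answering by a shifted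
list costs every user the same amount, a `laplaceCost`.

Lower bound: privacy forces, for a fixed signal, the likelihood `φ u` of the user `u` to be
log-Lipschitz with rate close to `ε`. On a half-line such a `φ` is `exp (-ε u)` times an increasing
function, hence a mixture of exponential tails (`mul_lintegral_Ioi_le_of_le_expTail`). Cut the line
at the middle of the sorted answers. From any point `c` beyond the cut, the answers serve the tail
no better than a list symmetric about `c` (`exists_isSymmetricList`), and for that list the tail
average equals the Laplace average. So no `φ` is served better than the Laplace weight by symmetric
lists (`mul_lintegral_le_of_le_laplaceCost`). Averaging over signals and over a prior on the users
gives `le_mechanismCost`, at a rate slightly above `ε`. Compactness of the answers in the extended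
reals and Fatou's lemma (`exists_laplaceCost_le`) remove the loss and provide an optimal list.

For `h z = z`, symmetry leaves a half-line problem, solved by recursion on the number of answers. By
memorylessness, only the distance to the next answer or midpoint has to be chosen at each stage;
both minimisations are instances of `1 + y ≤ exp y`. With `m` answers right of `c` and one at `c`,
the optimum is `1 / ((m + 1) ε)`; with `m + 1` answers, all to the right, it is `log ((m + 2) / (m +
1)) / ε`. The equality cases give gaps that telescope to the closed form. -/

/-! ### Comparison of exponentially weighted tails -/

/-- Measures ordered on upper sets are ordered on monotone functions. -/
theorem lintegral_le_of_forall_isUpperSet {μ ν : Measure ℝ}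
    (h : ∀ U : Set ℝ, IsUpperSet U → μ U ≤ ν U) {q : ℝ → ℝ≥0∞} (hq : Monotone q) :
    ∫⁻ x, q x ∂μ ≤ ∫⁻ x, q x ∂ν := by
  -- Layer cake: superlevel sets of a monotone function are upper sets. Truncation at `n` makes the
  -- values finite, as the real-valued layer-cake formula requires.
  have key : ∀ n : ℕ, ∫⁻ x, min (q x) n ∂μ ≤ ∫⁻ x, min (q x) n ∂ν := by
    intro n
    have hlt : ∀ x, min (q x) (n : ℝ≥0∞) ≠ ∞ := fun x =>
      ne_top_of_le_ne_top (ENNReal.natCast_ne_top n) (min_le_right _ _)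
    have hmono : Monotone fun x => (min (q x) (n : ℝ≥0∞)).toReal := fun x y hxy =>
      ENNReal.toReal_mono (hlt y) (min_le_min_right _ (hq hxy))
    have e : ∀ m : Measure ℝ, ∫⁻ x, min (q x) n ∂m =
        ∫⁻ t in Set.Ioi (0 : ℝ), m {x | t < (min (q x) (n : ℝ≥0∞)).toReal} := by
      intro m
      rw [← lintegral_eq_lintegral_meas_lt m (.of_forall fun x => ENNReal.toReal_nonneg)
        hmono.measurable.aemeasurable]
      simp_rw [ENNReal.ofReal_toReal (hlt _)]
    rw [e, e]
    exact lintegral_mono fun t => h _ fun x y hxy hx => lt_of_lt_of_le hx (hmono hxy)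
  have e : ∀ m : Measure ℝ, ∫⁻ x, q x ∂m = ⨆ n : ℕ, ∫⁻ x, min (q x) n ∂m := by
    intro m
    rw [← lintegral_iSup (fun n => hq.measurable.min measurable_const)
      fun i j hij x => min_le_min_left _ (by exact_mod_cast hij)]
    congr 1
    funext x
    rw [← inf_iSup_eq, ENNReal.iSup_natCast, inf_top_eq]
  rw [e, e]
  exact iSup_mono key

/-- The integral of `F` over `(c, ∞)` against the exponential law of rate `ε` started at `c`. -/
noncomputable def expTail (ε c : ℝ) (F : ℝ → ℝ≥0∞) : ℝ≥0∞ :=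
  ∫⁻ x in Set.Ioi c, ENNReal.ofReal (ε * Real.exp (-ε * (x - c))) * F x

theorem expTail_eq {ε : ℝ} (hε : 0 < ε) (c : ℝ) {F : ℝ → ℝ≥0∞} (hF : Measurable F) :
    expTail ε c F = ENNReal.ofReal (ε * Real.exp (ε * c)) *
      ∫⁻ x in Set.Ioi c, ENNReal.ofReal (Real.exp (-ε * x)) * F x := by
  rw [expTail, ← lintegral_const_mul _ (by fun_prop)]
  refine lintegral_congr fun x => ?_
  rw [← mul_assoc, ← ENNReal.ofReal_mul (by positivity), mul_assoc ε, ← Real.exp_add]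
  ring_nf

theorem lintegral_exp_Ioi {ε : ℝ} (hε : 0 < ε) (c : ℝ) :
    ∫⁻ x in Set.Ioi c, ENNReal.ofReal (Real.exp (-ε * x)) =
      ENNReal.ofReal (Real.exp (-ε * c) / ε) := by
  rw [← ofReal_integral_eq_lintegral_ofReal (integrableOn_exp_mul_Ioi (by linarith) c)
    (.of_forall fun x => (Real.exp_pos _).le), integral_exp_mul_Ioi (by linarith) c]
  congr 1
  field_simp

/-- The integral over an upper set is an integral over a half-line. -/
theorem exists_lintegral_inter_Ioi_eq {U : Set ℝ} (hU : IsUpperSet U) (c : ℝ) :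
    (U ∩ Set.Ioi c = ∅) ∨ ∃ c', c ≤ c' ∧ (U ∩ Set.Ioi c : Set ℝ) =ᵐ[volume] Set.Ioi c' := by
  rcases Set.eq_empty_or_nonempty (U ∩ Set.Ioi c) with h | h
  · exact Or.inl h
  right
  have hbdd : BddBelow (U ∩ Set.Ioi c) := ⟨c, fun x hx => (Set.mem_Ioi.1 hx.2).le⟩
  refine ⟨sInf (U ∩ Set.Ioi c), le_csInf h fun x hx => (Set.mem_Ioi.1 hx.2).le, ?_⟩
  refine Filter.EventuallyLE.antisymm ?_ ?_
  · exact (LE.le.eventuallyLE fun x hx => csInf_le hbdd hx).trans Ioi_ae_eq_Ici.symm.le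
  · refine LE.le.eventuallyLE fun x hx => ?_
    obtain ⟨y, hy, hyx⟩ := exists_lt_of_csInf_lt h hx
    exact ⟨hU hyx.le hy.1, lt_trans (Set.mem_Ioi.1 hy.2) hyx⟩

/-- A bound on all exponential tails of `F` to the right of `c` gives the same bound for every
weight whose logarithm decays at most at rate `ε`. -/
theorem mul_lintegral_Ioi_le_of_le_expTail {ε c : ℝ} (hε : 0 < ε) {F : ℝ → ℝ≥0∞}
    (hF : Measurable F) {l : ℝ≥0∞} (hl : ∀ c', c ≤ c' → l ≤ expTail ε c' F) {φ : ℝ → ℝ≥0∞}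
    (hφ : Monotone fun u => ENNReal.ofReal (Real.exp (ε * u)) * φ u) :
    l * ∫⁻ u in Set.Ioi c, φ u ≤ ∫⁻ u in Set.Ioi c, φ u * F u := by
  set q : ℝ → ℝ≥0∞ := fun u => ENNReal.ofReal (Real.exp (ε * u)) * φ u with hq
  have hφq : ∀ u, φ u = ENNReal.ofReal (Real.exp (-ε * u)) * q u := by
    intro u
    rw [hq]
    simp only
    rw [← mul_assoc, ← ENNReal.ofReal_mul (Real.exp_pos _).le, ← Real.exp_add]
    simp
  have hqm : Measurable q := hφ.measurable
  let d : ℝ → ℝ≥0∞ := fun u => ENNReal.ofReal (Real.exp (-ε * u))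
  have hd : Measurable d := by fun_prop
  -- The measures `l exp (-ε u) du` and `exp (-ε u) F u du` on `(c, ∞)` are compared on upper sets,
  -- which there are half-lines `(c', ∞)` up to a null set; on these the comparison is the
  -- hypothesis `hl`. Then the increasing `q` is integrated.
  have hstep : ∫⁻ u, q u ∂((volume.restrict (Set.Ioi c)).withDensity fun u => l * d u) ≤
      ∫⁻ u, q u ∂((volume.restrict (Set.Ioi c)).withDensity fun u => d u * F u) := by
    refine lintegral_le_of_forall_isUpperSet (fun U hU => ?_) hφ
    have hUm : MeasurableSet U := hU.ordConnected.measurableSet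
    rw [withDensity_apply _ hUm, withDensity_apply _ hUm, Measure.restrict_restrict hUm]
    rcases exists_lintegral_inter_Ioi_eq hU c with h | ⟨c', hc', h⟩
    · simp [h]
    rw [Measure.restrict_congr_set h, lintegral_const_mul _ hd, lintegral_exp_Ioi hε]
    have hpos : ENNReal.ofReal (ε * Real.exp (ε * c')) ≠ 0 := by
      rw [Ne, ENNReal.ofReal_eq_zero, not_le]; positivity
    rw [← ENNReal.mul_le_mul_iff_right hpos ENNReal.ofReal_ne_top, ← expTail_eq hε c' hF,
      mul_left_comm, ← ENNReal.ofReal_mul (by positivity)]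
    have : ε * Real.exp (ε * c') * (Real.exp (-ε * c') / ε) = 1 := by
      have h2 : Real.exp (ε * c') * Real.exp (-ε * c') = 1 := by
        rw [← Real.exp_add]; simp
      rw [← h2]
      field_simp
    rw [this, ENNReal.ofReal_one, mul_one]
    exact hl c' hc'
  rw [lintegral_withDensity_eq_lintegral_mul _ (hd.const_mul l) hqm,
    lintegral_withDensity_eq_lintegral_mul _
      (show Measurable fun u => d u * F u from hd.mul hF) hqm] at hstep
  have e1 : l * ∫⁻ u in Set.Ioi c, φ u = ∫⁻ u in Set.Ioi c, ((fun u => l * d u) * q) u := by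
    rw [← lintegral_const_mul _ (by
      have : φ = fun u => d u * q u := funext hφq
      rw [this]; exact hd.mul hqm)]
    refine lintegral_congr fun u => ?_
    rw [hφq u, Pi.mul_apply, mul_assoc]
  have e2 : ∫⁻ u in Set.Ioi c, φ u * F u =
      ∫⁻ u in Set.Ioi c, ((fun u => d u * F u) * q) u := by
    refine lintegral_congr fun u => ?_
    rw [hφq u, Pi.mul_apply, mul_right_comm]
  rw [e1, e2]
  exact hstep

/-- `φ` is a weight on the line which varies at most by the factor `exp (ε * dist)`. -/
def IsLogLipschitz (ε : ℝ) (φ : ℝ → ℝ≥0∞) : Prop :=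
  ∀ u v, φ u ≤ ENNReal.ofReal (Real.exp (ε * |u - v|)) * φ v

theorem IsLogLipschitz.monotone {ε : ℝ} {φ : ℝ → ℝ≥0∞} (h : IsLogLipschitz ε φ) :
    Monotone fun u => ENNReal.ofReal (Real.exp (ε * u)) * φ u := by
  intro u v huv
  calc ENNReal.ofReal (Real.exp (ε * u)) * φ u
      ≤ ENNReal.ofReal (Real.exp (ε * u)) *
        (ENNReal.ofReal (Real.exp (ε * |u - v|)) * φ v) := by gcongr; exact h u v
    _ = ENNReal.ofReal (Real.exp (ε * v)) * φ v := by
      rw [← mul_assoc, ← ENNReal.ofReal_mul (Real.exp_pos _).le, ← Real.exp_add,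
        abs_of_nonpos (by linarith)]
      ring_nf

theorem IsLogLipschitz.comp_neg {ε : ℝ} {φ : ℝ → ℝ≥0∞} (h : IsLogLipschitz ε φ) :
    IsLogLipschitz ε fun u => φ (-u) := by
  intro u v
  have := h (-u) (-v)
  rwa [neg_sub_neg, abs_sub_comm] at this

/-- Allows the signal densities to be multiplied by a Laplace prior on the users; the rates add. -/
theorem IsLogLipschitz.mul {ε δ : ℝ} {φ ψ : ℝ → ℝ≥0∞} (h : IsLogLipschitz ε φ)
    (h' : IsLogLipschitz δ ψ) : IsLogLipschitz (ε + δ) fun u => φ u * ψ u := by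
  intro u v
  calc φ u * ψ u ≤ (ENNReal.ofReal (Real.exp (ε * |u - v|)) * φ v) *
        (ENNReal.ofReal (Real.exp (δ * |u - v|)) * ψ v) := mul_le_mul' (h u v) (h' u v)
    _ = _ := by
      rw [add_mul, Real.exp_add, ENNReal.ofReal_mul (Real.exp_pos _).le]
      ring

theorem lintegral_comp_neg (f : ℝ → ℝ≥0∞) : ∫⁻ x, f (-x) = ∫⁻ x, f x :=
  (Measure.measurePreserving_neg (volume : Measure ℝ)).lintegral_comp_emb
    (MeasurableEquiv.neg ℝ).measurableEmbedding f

theorem lintegral_eq_Ioi_add_Ioi_neg (f : ℝ → ℝ≥0∞) (c : ℝ) :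
    ∫⁻ x, f x = (∫⁻ x in Set.Ioi c, f x) + ∫⁻ x in Set.Ioi (-c), f (-x) := by
  have e : ∫⁻ x in Set.Ioi (-c), f (-x) = ∫⁻ x in Set.Iio c, f x := by
    rw [← lintegral_indicator measurableSet_Ioi, ← lintegral_indicator measurableSet_Iio,
      ← lintegral_comp_neg ((Set.Iio c).indicator f)]
    refine lintegral_congr fun x => ?_
    by_cases hx : -c < x
    · rw [Set.indicator_of_mem (by simpa using hx), Set.indicator_of_mem]
      simp only [Set.mem_Iio]; linarith
    · rw [Set.indicator_of_notMem (by simpa using hx), Set.indicator_of_notMem]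
      simp only [Set.mem_Iio]; linarith
  rw [e, Measure.restrict_congr_set (Iio_ae_eq_Iic (a := c) (μ := volume)), add_comm,
    ← Set.compl_Iic, lintegral_add_compl _ measurableSet_Iic]

/-- A two-sided bound on exponential tails passes to all log-Lipschitz weights. -/
theorem mul_lintegral_le_of_le_expTail {ε : ℝ} (hε : 0 < ε) (c : ℝ) {F : ℝ → ℝ≥0∞}
    (hF : Measurable F) {l : ℝ≥0∞} (hr : ∀ c', c ≤ c' → l ≤ expTail ε c' F)
    (hl : ∀ c', -c ≤ c' → l ≤ expTail ε c' fun x => F (-x)) {φ : ℝ → ℝ≥0∞}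
    (hφ : IsLogLipschitz ε φ) : l * ∫⁻ u, φ u ≤ ∫⁻ u, φ u * F u := by
  rw [lintegral_eq_Ioi_add_Ioi_neg φ c, lintegral_eq_Ioi_add_Ioi_neg (fun u => φ u * F u) c,
    mul_add]
  exact add_le_add (mul_lintegral_Ioi_le_of_le_expTail hε hF hr hφ.monotone)
    (mul_lintegral_Ioi_le_of_le_expTail hε (hF.comp measurable_neg) hl hφ.comp_neg.monotone)

/-! ### Expected disutility under Laplace noise -/

theorem continuous_disutility {h : ℝ → ℝ} (hc : ContinuousOn h (Set.Ici 0)) :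
    Continuous fun x : ℝ => h |x| :=
  hc.comp_continuous continuous_abs fun x => abs_nonneg x

theorem measurable_minDisutility {h : ℝ → ℝ} (hc : ContinuousOn h (Set.Ici 0)) (k : ℕ) :
    Measurable fun p : ℝ × (Fin k → ℝ) => minDisutility h p.1 p.2 := by
  refine Measurable.iInf fun i => ENNReal.measurable_ofReal.comp ?_
  exact (continuous_disutility hc).measurable.comp
    (measurable_fst.sub ((measurable_pi_apply i).comp measurable_snd))

theorem measurable_minDisutility_left {h : ℝ → ℝ} (hc : ContinuousOn h (Set.Ici 0)) {k : ℕ}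
    (a : Fin k → ℝ) : Measurable fun u => minDisutility h u a := by
  have : Measurable fun u : ℝ => (u, a) := by fun_prop
  have := (measurable_minDisutility hc k).comp this
  exact this

/-- Answers at least as close to `u` as those of another list give a smaller disutility. -/
theorem minDisutility_le_of_forall_exists {h : ℝ → ℝ} (hm : MonotoneOn h (Set.Ici 0)) {k m : ℕ}
    {u v : ℝ} {a : Fin k → ℝ} {b : Fin m → ℝ} (H : ∀ i, ∃ j, |u - b j| ≤ |v - a i|) :
    minDisutility h u b ≤ minDisutility h v a := by
  refine le_iInf fun i => ?_
  obtain ⟨j, hj⟩ := H i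
  exact (iInf_le _ j).trans
    (ENNReal.ofReal_le_ofReal (hm (Set.mem_Ici.2 (abs_nonneg _)) (Set.mem_Ici.2 (abs_nonneg _)) hj))

theorem minDisutility_comp_perm (h : ℝ → ℝ) {k : ℕ} (u : ℝ) (a : Fin k → ℝ)
    (σ : Equiv.Perm (Fin k)) : minDisutility h u (a ∘ σ) = minDisutility h u a :=
  Equiv.iInf_comp (g := fun i => ENNReal.ofReal (h |u - a i|)) σ

theorem minDisutility_neg (h : ℝ → ℝ) {k : ℕ} (u : ℝ) (a : Fin k → ℝ) :
    minDisutility h (-u) a = minDisutility h u (-a) := by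
  unfold minDisutility
  congr 1
  funext i
  rw [Pi.neg_apply, ← abs_neg (-u - a i)]
  ring_nf

theorem expTail_mono {ε c : ℝ} {F G : ℝ → ℝ≥0∞} (h : ∀ x, c < x → F x ≤ G x) :
    expTail ε c F ≤ expTail ε c G :=
  setLIntegral_mono' measurableSet_Ioi fun x hx => by gcongr; exact h x hx

theorem expTail_add_right (ε c d : ℝ) (F : ℝ → ℝ≥0∞) :
    expTail ε (c + d) F = expTail ε d fun x => F (c + x) := by
  unfold expTail
  have hp := measurePreserving_add_left (volume : Measure ℝ) c
  rw [← hp.setLIntegral_comp_preimage_emb (MeasurableEquiv.addLeft c).measurableEmbedding]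
  simp only [Set.preimage_const_add_Ioi, add_sub_cancel_left]
  refine lintegral_congr fun x => ?_
  ring_nf

theorem lintegral_laplaceNoise (ε : ℝ) {F : ℝ → ℝ≥0∞} (hF : Measurable F) :
    ∫⁻ x, F x ∂(laplaceNoise ε) =
      ∫⁻ x, ENNReal.ofReal (ε / 2 * Real.exp (-ε * |x|)) * F x := by
  rw [laplaceNoise, lintegral_withDensity_eq_lintegral_mul _ (by fun_prop) hF]
  rfl

theorem lintegral_laplaceNoise_eq_expTail (ε : ℝ) {F : ℝ → ℝ≥0∞} (hF : Measurable F) :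
    ∫⁻ x, F x ∂(laplaceNoise ε) =
      (expTail ε 0 F + expTail ε 0 fun x => F (-x)) / 2 := by
  have e : ∀ G : ℝ → ℝ≥0∞, Measurable G →
      ∫⁻ x in Set.Ioi 0, ENNReal.ofReal (ε / 2 * Real.exp (-ε * |x|)) * G x =
        expTail ε 0 G / 2 := by
    intro G hG
    rw [expTail, ENNReal.div_eq_inv_mul, ← lintegral_const_mul _ (by fun_prop)]
    refine setLIntegral_congr_fun measurableSet_Ioi fun x hx => ?_
    have : ε / 2 * Real.exp (-ε * |x|) = ε * Real.exp (-ε * (x - 0)) * 2⁻¹ := by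
      rw [abs_of_pos hx]; ring_nf
    rw [this, ENNReal.ofReal_mul' (by norm_num), ENNReal.ofReal_inv_of_pos (by norm_num)]
    norm_num
    ring
  rw [lintegral_laplaceNoise ε hF, lintegral_eq_Ioi_add_Ioi_neg _ 0, e F hF, neg_zero,
    ENNReal.add_div, ← e (fun x => F (-x)) (hF.comp measurable_neg)]
  simp only [abs_neg]

/-- Expected disutility of the answers `a` for a user with Laplace distributed position. -/
noncomputable def laplaceCost (h : ℝ → ℝ) {k : ℕ} (ε : ℝ) (a : Fin k → ℝ) : ℝ≥0∞ :=
  ∫⁻ x, minDisutility h x a ∂(laplaceNoise ε)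

/-- The Laplace average is the mean of two exponential tails from `0`, and each is dominated by the
tail of `F` from `c` after translation by `c`. -/
theorem laplaceCost_le_expTail {h : ℝ → ℝ} (hc : ContinuousOn h (Set.Ici 0)) {k : ℕ} (ε c : ℝ)
    {b : Fin k → ℝ} {F : ℝ → ℝ≥0∞} (hpos : ∀ x, 0 < x → minDisutility h x b ≤ F (c + x))
    (hneg : ∀ x, 0 < x → minDisutility h (-x) b ≤ F (c + x)) :
    laplaceCost h ε b ≤ expTail ε c F := by
  rw [laplaceCost, lintegral_laplaceNoise_eq_expTail ε (measurable_minDisutility_left hc b)]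
  have e := expTail_add_right ε c 0 F
  rw [add_zero] at e
  rw [e]
  refine (ENNReal.div_le_div_right (add_le_add (expTail_mono hpos) (expTail_mono hneg)) 2).trans ?_
  rw [← two_mul, mul_comm, ENNReal.mul_div_cancel_right (by norm_num) (by norm_num)]

/-- Lists of answers which are symmetric about `0`, the second half being nonnegative. -/
structure IsSymmetricList {k : ℕ} (b : Fin k → ℝ) : Prop where
  rev : ∀ i, b i.rev = -b i
  nonneg : ∀ i : Fin k, k / 2 ≤ (i : ℕ) → 0 ≤ b i

theorem IsSymmetricList.minDisutility_neg {k : ℕ} {b : Fin k → ℝ} (hb : IsSymmetricList b)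
    (h : ℝ → ℝ) (x : ℝ) : minDisutility h (-x) b = minDisutility h x b := by
  rw [_root_.minDisutility_neg, ← minDisutility_comp_perm h x b Fin.revPerm]
  congr 1
  funext i
  simp [hb.rev]

/-- Midpoint of the two (possibly equal) middle entries. -/
noncomputable def middle {k : ℕ} (hk : 0 < k) (a : Fin k → ℝ) : ℝ :=
  (a ⟨(k - 1) / 2, by omega⟩ + a ⟨k / 2, by omega⟩) / 2

theorem middle_neg_rev {k : ℕ} (hk : 0 < k) (a : Fin k → ℝ) :
    middle hk (fun i => -a i.rev) = -middle hk a := by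
  have e1 : (⟨(k - 1) / 2, by omega⟩ : Fin k).rev = ⟨k / 2, by omega⟩ := by
    ext; simp only [Fin.val_rev]; omega
  have e2 : (⟨k / 2, by omega⟩ : Fin k).rev = ⟨(k - 1) / 2, by omega⟩ := by
    ext; simp only [Fin.val_rev]; omega
  rw [middle, middle, e1, e2]
  ring

/-- Seen from a point `c` to the right of the middle, a sorted list of answers is no better than
a symmetric list centred at `c`. -/
theorem exists_isSymmetricList {k : ℕ} (hk : 0 < k) {a : Fin k → ℝ} (ha : Monotone a) {c : ℝ}
    (hc : middle hk a ≤ c) : ∃ b : Fin k → ℝ, IsSymmetricList b ∧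
      ∀ x, 0 < x → ∀ i, ∃ j, |x - b j| ≤ |c + x - a i| := by
  -- Answers left of `c` are moved to `c`, everything is recentred at `0`, and the upper half is
  -- reflected.
  set p : Fin k → ℝ := fun i => max (a i - c) 0 with hp
  have hmid : a ⟨(k - 1) / 2, by omega⟩ ≤ c := by
    have : a ⟨(k - 1) / 2, by omega⟩ ≤ a ⟨k / 2, by omega⟩ := ha (by simp only [Fin.mk_le_mk]; omega)
    rw [middle] at hc
    linarith
  refine ⟨fun i => if k / 2 ≤ (i : ℕ) then p i else -p i.rev, ⟨fun i => ?_, fun i hi => ?_⟩,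
    fun x hx i => ?_⟩
  · by_cases hi : k / 2 ≤ (i : ℕ)
    · by_cases hr : k / 2 ≤ (i.rev : ℕ)
      -- Both `i` and its reverse lie in the upper half only for the central index of an odd list;
      -- there symmetry needs the value `0`, which `hmid` provides.
      · have hi' : i = ⟨(k - 1) / 2, by omega⟩ := by
          ext; rw [Fin.val_rev] at hr; simp only; omega
        have hr' : i.rev = ⟨(k - 1) / 2, by omega⟩ := by
          ext; rw [Fin.val_rev] at hr ⊢; simp only; omega
        have h0 : p ⟨(k - 1) / 2, by omega⟩ = 0 := by
          simp only [hp]; exact max_eq_right (by linarith)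
        simp only [if_pos hi, if_pos hr]
        rw [hr', hi', h0, neg_zero]
      · simp only [if_pos hi, if_neg hr, Fin.rev_rev]
    · have hr : k / 2 ≤ (i.rev : ℕ) := by rw [Fin.val_rev]; omega
      simp only [if_neg hi, if_pos hr, neg_neg]
  · simp only [if_pos hi]
    exact le_max_right _ _
  · rcases lt_or_ge c (a i) with hi | hi
    · have hi' : k / 2 ≤ (i : ℕ) := by
        by_contra hcon
        have : a i ≤ a ⟨(k - 1) / 2, by omega⟩ := ha (by rw [Fin.le_def]; simp only; omega)
        linarith
      refine ⟨i, le_of_eq ?_⟩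
      simp only [if_pos hi', hp]
      rw [max_eq_left (by linarith)]
      ring_nf
    -- An answer at or left of `c` is replaced by the innermost entry of the upper half. If that
    -- entry exceeds `c`, the bound `middle hk a ≤ c` makes it no farther from `c` than any answer
    -- in the lower half.
    · refine ⟨⟨k / 2, by omega⟩, ?_⟩
      simp only [le_refl, if_true, hp]
      rw [abs_of_nonneg (show 0 ≤ c + x - a i by linarith)]
      rcases le_total (a ⟨k / 2, by omega⟩) c with hj | hj
      · rw [max_eq_right (by linarith), abs_le]
        constructor <;> linarith
      · rw [max_eq_left (by linarith), abs_le]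
        refine ⟨?_, by linarith⟩
        rcases le_or_gt (a i) (a ⟨(k - 1) / 2, by omega⟩) with h1 | h1
        · rw [middle] at hc
          linarith
        · have h2 : a ⟨k / 2, by omega⟩ ≤ a i := ha (by
            rw [Fin.le_def]; simp only
            by_contra hcon
            have := ha (show i ≤ ⟨(k - 1) / 2, by omega⟩ by rw [Fin.le_def]; simp only; omega)
            linarith)
          linarith

/-- Every weight whose logarithm is `ε`-Lipschitz is served, on average, no better than the
Laplace weight of rate `ε` by a symmetric list of answers. -/
theorem mul_lintegral_le_of_le_laplaceCost {h : ℝ → ℝ} (hc : ContinuousOn h (Set.Ici 0))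
    (hm : MonotoneOn h (Set.Ici 0)) {ε : ℝ} (hε : 0 < ε) {k : ℕ} (hk : 0 < k) {l : ℝ≥0∞}
    (hl : ∀ b : Fin k → ℝ, IsSymmetricList b → l ≤ laplaceCost h ε b) {φ : ℝ → ℝ≥0∞}
    (hφ : IsLogLipschitz ε φ) (a : Fin k → ℝ) :
    l * ∫⁻ u, φ u ≤ ∫⁻ u, φ u * minDisutility h u a := by
  have key : ∀ a : Fin k → ℝ, Monotone a → ∀ c, middle hk a ≤ c →
      l ≤ expTail ε c fun u => minDisutility h u a := by
    intro a ha c hac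
    obtain ⟨b, hb, H⟩ := exists_isSymmetricList hk ha hac
    have hpos : ∀ x, 0 < x → minDisutility h x b ≤ minDisutility h (c + x) a := fun x hx =>
      minDisutility_le_of_forall_exists hm (H x hx)
    refine (hl b hb).trans (laplaceCost_le_expTail hc ε c hpos fun x hx => ?_)
    rw [hb.minDisutility_neg]
    exact hpos x hx
  have hs := Tuple.monotone_sort a
  set σ := Tuple.sort a
  have e : ∀ u, minDisutility h u a = minDisutility h u (a ∘ σ) := fun u =>
    (minDisutility_comp_perm h u a σ).symm
  simp_rw [e]
  refine mul_lintegral_le_of_le_expTail hε (middle hk (a ∘ σ))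
    (measurable_minDisutility_left hc _) (key _ hs) (fun c hac => ?_) hφ
  -- The left half-line is the right half-line for the negated list, reversed so as to stay sorted.
  rw [← middle_neg_rev] at hac
  refine (key _ (fun i j hij => neg_le_neg (hs (Fin.rev_le_rev.2 hij))) c hac).trans_eq ?_
  congr 1
  funext u
  rw [minDisutility_neg, ← minDisutility_comp_perm h u (-(a ∘ σ)) Fin.revPerm]
  rfl

theorem expTail_one {ε : ℝ} (hε : 0 < ε) (c : ℝ) : expTail ε c (fun _ => 1) = 1 := by
  rw [expTail_eq hε c measurable_const]
  simp only [mul_one]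
  rw [lintegral_exp_Ioi hε, ← ENNReal.ofReal_mul (by positivity), ← ENNReal.ofReal_one]
  congr 1
  have : Real.exp (ε * c) * Real.exp (-ε * c) = 1 := by rw [← Real.exp_add]; simp
  rw [← this]
  field_simp

theorem isProbabilityMeasure_laplaceNoise {ε : ℝ} (hε : 0 < ε) :
    IsProbabilityMeasure (laplaceNoise ε) := by
  constructor
  rw [← lintegral_one, lintegral_laplaceNoise_eq_expTail ε measurable_const, expTail_one hε]
  rw [one_add_one_eq_two]
  exact ENNReal.div_self (by norm_num) (by norm_num)

theorem lintegral_laplaceWeight {ε : ℝ} (hε : 0 < ε) :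
    ∫⁻ x, ENNReal.ofReal (ε / 2 * Real.exp (-ε * |x|)) = 1 := by
  have := isProbabilityMeasure_laplaceNoise hε
  have h1 := lintegral_laplaceNoise ε (F := fun _ => 1) measurable_const
  simpa using h1.symm

theorem isLogLipschitz_laplaceWeight {ε : ℝ} (hε : 0 < ε) :
    IsLogLipschitz ε fun x => ENNReal.ofReal (ε / 2 * Real.exp (-ε * |x|)) := by
  intro u v
  rw [← ENNReal.ofReal_mul (Real.exp_pos _).le, mul_left_comm, ← Real.exp_add]
  refine ENNReal.ofReal_le_ofReal ?_
  gcongr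
  have : |v| ≤ |u - v| + |u| := by
    have := abs_sub_abs_le_abs_sub v u
    rw [abs_sub_comm v u] at this
    linarith
  nlinarith

/-! ### Lower bound for private mechanisms -/

/-- A `g`-private user action is `(g'(0) + δ)`-private for every `δ > 0`. -/
theorem IsGeoPrivate.le_exp_add_mul {g : ℝ≥0 → ℝ≥0∞} {ε : ℝ} (hg : IsPrivacyProfile g ε)
    {Z : Type v} [MeasurableSpace Z] {P : ℝ → Measure Z} (hP : IsGeoPrivate g P) {δ : ℝ}
    (hδ : 0 < δ) (u₁ u₂ : ℝ) {S : Set Z} (hS : MeasurableSet S) :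
    P u₁ S ≤ ENNReal.ofReal (Real.exp ((ε + δ) * |u₁ - u₂|)) * P u₂ S := by
  have hlt : ENNReal.ofReal ε < ENNReal.ofReal (ε + δ) :=
    (ENNReal.ofReal_lt_ofReal_iff (by linarith [hg.deriv_pos])).2 (by linarith)
  -- Near `0`, `g t ≤ (ε + δ) t`. Larger distances are split into steps shorter than `r`, along
  -- which the exponents add up.
  have hev := hg.deriv_zero.eventually (gt_mem_nhds hlt)
  rw [eventually_nhdsWithin_iff, Metric.eventually_nhds_iff] at hev
  obtain ⟨r, hr, H⟩ := hev
  have small : ∀ u v : ℝ, |u - v| < r →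
      P u S ≤ ENNReal.ofReal (Real.exp ((ε + δ) * |u - v|)) * P v S := by
    intro u v huv
    rcases eq_or_ne u v with rfl | hne
    · simp
    have hd : nndist u v ≠ 0 := by simpa using hne
    have hco : ((nndist u v : ℝ≥0) : ℝ≥0∞) = ENNReal.ofReal |u - v| := by
      rw [← edist_nndist, edist_dist, Real.dist_eq]
    have h1 := H (y := nndist u v) (by
      rw [NNReal.dist_eq, coe_nndist, Real.dist_eq]; simpa using huv) hd
    have h2 : g (nndist u v) ≤ ENNReal.ofReal ((ε + δ) * |u - v|) := by
      rw [ENNReal.ofReal_mul (by linarith [hg.deriv_pos]), ← hco]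
      exact (ENNReal.div_le_iff (by exact_mod_cast hd) ENNReal.coe_ne_top).1 h1.le
    refine (hP.le_exp_mul u v (ne_top_of_le_ne_top ENNReal.ofReal_ne_top h2) S hS).trans ?_
    gcongr
    exact ENNReal.toReal_le_of_le_ofReal
      (mul_nonneg (by linarith [hg.deriv_pos]) (abs_nonneg _)) h2
  have chain : ∀ (n : ℕ) (u v : ℝ), |u - v| < n * r →
      P u S ≤ ENNReal.ofReal (Real.exp ((ε + δ) * |u - v|)) * P v S := by
    intro n
    induction n with
    | zero => intro u v h; exact absurd h (by simp)
    | succ n ih =>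
      intro u v h
      -- The case `n = 0` is separate because the strict bound on the remaining `n` steps needs `n >
      -- 0`.
      rcases Nat.eq_zero_or_pos n with rfl | hn
      · exact small u v (by simpa using h)
      have hn' : (0 : ℝ) < n := by exact_mod_cast hn
      push_cast at h
      set w : ℝ := u + (v - u) / (n + 1) with hw
      have e1 : |u - w| = |u - v| / (n + 1) := by
        rw [show u - w = (u - v) / (n + 1) by rw [hw]; ring, abs_div,
          abs_of_pos (by positivity : (0 : ℝ) < n + 1)]
      have e2 : |w - v| = n * (|u - v| / (n + 1)) := by
        rw [show w - v = n * ((u - v) / (n + 1)) by rw [hw]; field_simp; ring, abs_mul, abs_div,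
          abs_of_pos (by positivity : (0 : ℝ) < n + 1), abs_of_pos hn']
      have hlt : |u - v| / (n + 1) < r := by
        rw [div_lt_iff₀ (by positivity)]; linarith
      calc P u S ≤ ENNReal.ofReal (Real.exp ((ε + δ) * |u - w|)) * P w S :=
            small u w (by rw [e1]; exact hlt)
        _ ≤ ENNReal.ofReal (Real.exp ((ε + δ) * |u - w|)) *
            (ENNReal.ofReal (Real.exp ((ε + δ) * |w - v|)) * P v S) := by
            gcongr
            exact ih w v (by rw [e2]; gcongr)
        _ = _ := by
            rw [← mul_assoc, ← ENNReal.ofReal_mul (Real.exp_pos _).le, ← Real.exp_add, e1, e2]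
            congr 3
            field_simp
            ring
  obtain ⟨n, hn⟩ := exists_nat_gt (|u₁ - u₂| / r)
  exact chain n u₁ u₂ (by rwa [div_lt_iff₀ hr] at hn)

/-- A private family of laws has densities, log-Lipschitz in the user, with respect to a fixed
law. -/
theorem exists_isLogLipschitz_density {Z : Type v} [MeasurableSpace Z] {P : ℝ → Measure Z}
    [∀ u, IsProbabilityMeasure (P u)] {ε : ℝ} (hε : 0 < ε)
    (hP : ∀ u v S, MeasurableSet S → P u S ≤ ENNReal.ofReal (Real.exp (ε * |u - v|)) * P v S) :
    ∃ p : ℝ → Z → ℝ≥0∞, Measurable (Function.uncurry p) ∧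
      (∀ s, IsLogLipschitz ε fun u => p u s) ∧ (∀ u, (P 0).withDensity (p u) ≤ P u) ∧
      ∀ u, 1 ≤ ∫⁻ s, p u s ∂P 0 := by
  have hac : ∀ u v, P u ≪ P v := fun u v =>
    Measure.AbsolutelyContinuous.mk fun S hS h0 => by
      have := hP u v S hS
      rw [h0, mul_zero] at this
      exact le_antisymm this zero_le
  -- Radon–Nikodym derivatives are log-Lipschitz in the user only almost everywhere. This
  -- regularisation over rational users is log-Lipschitz for every `s`, and jointly measurable as a
  -- countable supremum.
  let p : ℝ → Z → ℝ≥0∞ := fun u s =>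
    ⨆ r : ℚ, ENNReal.ofReal (Real.exp (-ε * |u - r|)) * (P r).rnDeriv (P 0) s
  have hpm : ∀ u, Measurable (p u) := fun u =>
    Measurable.iSup fun r => (Measure.measurable_rnDeriv _ _).const_mul _
  refine ⟨p, ?_, fun s u v => ?_, fun u => ?_, fun u => ?_⟩
  · refine Measurable.iSup fun r => Measurable.mul ?_ ?_
    · fun_prop
    · exact (Measure.measurable_rnDeriv _ _).comp measurable_snd
  · refine iSup_le fun r => ?_
    calc ENNReal.ofReal (Real.exp (-ε * |u - r|)) * (P r).rnDeriv (P 0) s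
        ≤ ENNReal.ofReal (Real.exp (ε * |u - v|)) *
          (ENNReal.ofReal (Real.exp (-ε * |v - r|)) * (P r).rnDeriv (P 0) s) := by
          rw [← mul_assoc, ← ENNReal.ofReal_mul (Real.exp_pos _).le, ← Real.exp_add]
          gcongr
          have := abs_sub_le v u (r : ℝ)
          rw [abs_sub_comm v u] at this
          nlinarith
      _ ≤ _ := by
          gcongr
          exact le_iSup (fun r : ℚ => ENNReal.ofReal (Real.exp (-ε * |v - r|)) *
            (P r).rnDeriv (P 0) s) r
  -- Privacy puts each of the countably many terms below the density of `P u` almost everywhere.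
  · have hle : p u ≤ᵐ[P 0] (P u).rnDeriv (P 0) := by
      have : ∀ r : ℚ, (fun s => ENNReal.ofReal (Real.exp (-ε * |u - r|)) *
          (P r).rnDeriv (P 0) s) ≤ᵐ[P 0] (P u).rnDeriv (P 0) := by
        intro r
        refine ae_le_of_forall_setLIntegral_le_of_sigmaFinite
          ((Measure.measurable_rnDeriv _ _).const_mul _) fun S hS _ => ?_
        rw [lintegral_const_mul _ (Measure.measurable_rnDeriv _ _),
          Measure.setLIntegral_rnDeriv (hac _ _), Measure.setLIntegral_rnDeriv (hac _ _)]
        calc ENNReal.ofReal (Real.exp (-ε * |u - r|)) * P r S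
            ≤ ENNReal.ofReal (Real.exp (-ε * |u - r|)) *
              (ENNReal.ofReal (Real.exp (ε * |(r : ℝ) - u|)) * P u S) := by
              gcongr; exact hP _ _ S hS
          _ = P u S := by
              rw [← mul_assoc, ← ENNReal.ofReal_mul (Real.exp_pos _).le, ← Real.exp_add,
                abs_sub_comm]
              simp
      filter_upwards [ae_all_iff.2 this] with s hs
      exact iSup_le hs
    calc (P 0).withDensity (p u) ≤ (P 0).withDensity ((P u).rnDeriv (P 0)) :=
          withDensity_mono hle
      _ = P u := Measure.withDensity_rnDeriv_eq _ _ (hac _ _)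
  -- Each term has mass `exp (-ε |u - r|)`; letting rational `r` approach `u` gives mass at least
  -- `1`.
  · have hr : ∀ r : ℚ, ENNReal.ofReal (Real.exp (-ε * |u - r|)) ≤ ∫⁻ s, p u s ∂P 0 := by
      intro r
      calc ENNReal.ofReal (Real.exp (-ε * |u - r|))
          = ∫⁻ s, ENNReal.ofReal (Real.exp (-ε * |u - r|)) * (P r).rnDeriv (P 0) s ∂P 0 := by
            rw [lintegral_const_mul _ (Measure.measurable_rnDeriv _ _),
              Measure.lintegral_rnDeriv (hac _ _), measure_univ, mul_one]
        _ ≤ _ := lintegral_mono fun s => le_iSup (fun r : ℚ =>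
            ENNReal.ofReal (Real.exp (-ε * |u - r|)) * (P r).rnDeriv (P 0) s) r
    have hcl : IsClosed {x : ℝ | ENNReal.ofReal (Real.exp (-ε * |u - x|)) ≤
        ∫⁻ s, p u s ∂P 0} := isClosed_le
      (ENNReal.continuous_ofReal.comp (by fun_prop)) continuous_const
    have := (Rat.denseRange_cast (𝕜 := ℝ)).induction_on (p := fun x : ℝ =>
      ENNReal.ofReal (Real.exp (-ε * |u - x|)) ≤ ∫⁻ s, p u s ∂P 0) u hcl hr
    simpa using this

theorem measurable_expected_minDisutility {h : ℝ → ℝ} (hc : ContinuousOn h (Set.Ici 0)) {k : ℕ}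
    {Z : Type v} [MeasurableSpace Z] (Q : Kernel Z (Fin k → ℝ)) [IsMarkovKernel Q] :
    Measurable fun x : ℝ × Z => ∫⁻ a, minDisutility h x.1 a ∂(Q x.2) := by
  have h1 : Measurable fun y : (ℝ × Z) × (Fin k → ℝ) => (y.1.1, y.2) := by fun_prop
  have h2 := (measurable_minDisutility hc k).comp h1
  exact Measurable.lintegral_kernel_prod_right
    (κ := Q.comap (Prod.snd : ℝ × Z → Z) measurable_snd)
    (f := fun (x : ℝ × Z) a => minDisutility h x.1 a) h2

/-- No private mechanism beats all symmetric lists of answers to a user perturbed by Laplace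
noise of a slightly larger rate. -/
theorem le_mechanismCost {h : ℝ → ℝ} (hc : ContinuousOn h (Set.Ici 0))
    (hm : MonotoneOn h (Set.Ici 0)) {ε δ : ℝ} (hε : 0 < ε) (hδ : 0 < δ) {k : ℕ} (hk : 0 < k)
    {l : ℝ≥0∞} (hl : ∀ b : Fin k → ℝ, IsSymmetricList b → l ≤ laplaceCost h (ε + δ) b)
    {Z : Type v} [MeasurableSpace Z] {P : ℝ → Measure Z} [∀ u, IsProbabilityMeasure (P u)]
    (hP : ∀ u v S, MeasurableSet S → P u S ≤ ENNReal.ofReal (Real.exp (ε * |u - v|)) * P v S)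
    (Q : Kernel Z (Fin k → ℝ)) [IsMarkovKernel Q] : l ≤ mechanismCost h P Q := by
  obtain ⟨p, hpm, hpl, hpd, hp1⟩ := exists_isLogLipschitz_density hε hP
  -- A Laplace prior on the users: it has total mass `1`, so a supremum over users bounds the
  -- average, and it costs only `δ` in the log-Lipschitz rate.
  set w : ℝ → ℝ≥0∞ := fun x => ENNReal.ofReal (δ / 2 * Real.exp (-δ * |x|)) with hw
  have hwm : Measurable w := by fun_prop
  set G : ℝ → Z → ℝ≥0∞ := fun u s => ∫⁻ a, minDisutility h u a ∂(Q s) with hG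
  have hGm : Measurable (Function.uncurry G) := measurable_expected_minDisutility hc Q
  have hpu : ∀ u, Measurable (p u) := fun u => hpm.of_uncurry_left
  have hps : ∀ s, Measurable fun u => p u s := fun s => hpm.of_uncurry_right
  have hpwm : Measurable fun x : Z × ℝ => p x.2 x.1 * w x.2 :=
    (hpm.comp measurable_swap).mul (hwm.comp measurable_snd)
  have hpwGm : Measurable fun x : Z × ℝ => p x.2 x.1 * w x.2 * G x.2 x.1 :=
    hpwm.mul (hGm.comp measurable_swap)
  have step : ∀ s, l * ∫⁻ u, p u s * w u ≤ ∫⁻ u, p u s * w u * G u s := by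
    intro s
    have hφm : Measurable fun u => p u s * w u := (hps s).mul hwm
    calc l * ∫⁻ u, p u s * w u = ∫⁻ _, l * (∫⁻ u, p u s * w u) ∂(Q s) := by simp
      _ ≤ ∫⁻ a, (∫⁻ u, p u s * w u * minDisutility h u a) ∂(Q s) :=
          lintegral_mono fun a => mul_lintegral_le_of_le_laplaceCost hc hm (by linarith) hk hl
            ((hpl s).mul (isLogLipschitz_laplaceWeight hδ)) a
      _ = ∫⁻ u, ∫⁻ a, p u s * w u * minDisutility h u a ∂(Q s) := by
          refine lintegral_lintegral_swap (Measurable.aemeasurable ?_)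
          exact (hφm.comp measurable_snd).mul
            ((measurable_minDisutility hc k).comp measurable_swap)
      _ = _ := by
          refine lintegral_congr fun u => ?_
          have : Measurable fun a : Fin k → ℝ => (u, a) := by fun_prop
          have h3 := (measurable_minDisutility hc k).comp this
          exact lintegral_const_mul _ h3
  calc l = l * ∫⁻ u, w u := by rw [lintegral_laplaceWeight hδ, mul_one]
    _ ≤ l * ∫⁻ u, ∫⁻ s, p u s * w u ∂P 0 := by
        gcongr with u
        rw [lintegral_mul_const _ (hpu u)]
        exact le_mul_of_one_le_left zero_le (hp1 u)
    _ = ∫⁻ s, l * (∫⁻ u, p u s * w u) ∂P 0 := by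
        rw [lintegral_const_mul _ hpwm.lintegral_prod_right',
          lintegral_lintegral_swap (f := fun s u => p u s * w u) hpwm.aemeasurable]
    _ ≤ ∫⁻ s, (∫⁻ u, p u s * w u * G u s) ∂P 0 := lintegral_mono step
    _ = ∫⁻ u, ∫⁻ s, p u s * w u * G u s ∂P 0 :=
        lintegral_lintegral_swap (f := fun s u => p u s * w u * G u s) hpwGm.aemeasurable
    _ ≤ ∫⁻ u, w u * mechanismCost h P Q := by
        refine lintegral_mono fun u => ?_
        have hGu : Measurable (G u) := hGm.of_uncurry_left
        calc ∫⁻ s, p u s * w u * G u s ∂P 0 = w u * ∫⁻ s, (p u * G u) s ∂P 0 := by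
              rw [← lintegral_const_mul _ ((hpu u).mul hGu)]
              refine lintegral_congr fun s => ?_
              rw [Pi.mul_apply]; ring
          _ = w u * ∫⁻ s, G u s ∂((P 0).withDensity (p u)) := by
              rw [lintegral_withDensity_eq_lintegral_mul _ (hpu u) hGu]
          _ ≤ w u * ∫⁻ s, G u s ∂(P u) := by gcongr; exact hpd u
          _ ≤ _ := by
              gcongr
              exact le_iSup (fun u => ∫⁻ s, ∫⁻ a, minDisutility h u a ∂(Q s) ∂(P u)) u
    _ = mechanismCost h P Q := by
        rw [lintegral_mul_const _ hwm, lintegral_laplaceWeight hδ, one_mul]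

/-! ### Existence of optimal answers -/

theorem tendsto_atTop_of_tendsto_nhds_top {x : ℕ → ℝ}
    (h : Tendsto (fun n => (x n : EReal)) atTop (𝓝 ⊤)) : Tendsto x atTop atTop :=
  tendsto_atTop.2 fun b => by
    filter_upwards [EReal.tendsto_nhds_top_iff_real.1 h b] with n hn
    exact (EReal.coe_lt_coe_iff.1 hn).le

theorem tendsto_atBot_of_tendsto_nhds_bot {x : ℕ → ℝ}
    (h : Tendsto (fun n => (x n : EReal)) atTop (𝓝 ⊥)) : Tendsto x atTop atBot :=
  tendsto_atBot.2 fun b => by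
    filter_upwards [EReal.tendsto_nhds_bot_iff_real.1 h b] with n hn
    exact (EReal.coe_lt_coe_iff.1 hn).le

/-- The disutility is lower semicontinuous in the answer, answers which escape to infinity being
replaced by `0`. -/
theorem eventually_lt_disutility {h : ℝ → ℝ} (hc : ContinuousOn h (Set.Ici 0))
    (hm : MonotoneOn h (Set.Ici 0)) {a : ℕ → ℝ} {α : EReal}
    (ha : Tendsto (fun n => (a n : EReal)) atTop (𝓝 α)) (x : ℝ) {y : ℝ≥0∞}
    (hy : y < ENNReal.ofReal (h |x - α.toReal|)) :
    ∀ᶠ n in atTop, y < ENNReal.ofReal (h |x - a n|) := by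
  have far : ∀ b : ℝ, |x| ≤ |x - b| →
      ENNReal.ofReal (h |x|) ≤ ENNReal.ofReal (h |x - b|) := fun b hb =>
    ENNReal.ofReal_le_ofReal (hm (Set.mem_Ici.2 (abs_nonneg _)) (Set.mem_Ici.2 (abs_nonneg _)) hb)
  induction α with
  | bot =>
    filter_upwards [(tendsto_atBot_of_tendsto_nhds_bot ha).eventually_le_atBot (-(2 * |x|))]
      with n hn
    rw [EReal.toReal_bot, sub_zero] at hy
    refine hy.trans_le (far _ ?_)
    have := neg_abs_le x
    exact le_trans (by linarith) (le_abs_self _)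
  | top =>
    filter_upwards [(tendsto_atTop_of_tendsto_nhds_top ha).eventually_ge_atTop (2 * |x|)]
      with n hn
    rw [EReal.toReal_top, sub_zero] at hy
    refine hy.trans_le (far _ ?_)
    have := le_abs_self x
    exact le_trans (by linarith) (neg_le_abs _)
  | coe r =>
    rw [EReal.toReal_coe] at hy
    have h1 : Tendsto a atTop (𝓝 r) := EReal.tendsto_coe.1 ha
    have h2 : Tendsto (fun n => ENNReal.ofReal (h |x - a n|)) atTop
        (𝓝 (ENNReal.ofReal (h |x - r|))) :=
      ENNReal.tendsto_ofReal (((continuous_disutility hc).tendsto (x - r)).comp (h1.const_sub x))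
    exact h2.eventually_const_lt hy

/-- Compactness: near-optimal answers for nearby rates yield answers for the limit rate. -/
theorem exists_laplaceCost_le {h : ℝ → ℝ} (hc : ContinuousOn h (Set.Ici 0))
    (hm : MonotoneOn h (Set.Ici 0)) {k : ℕ} {e : ℕ → ℝ} {ε : ℝ} (he : Tendsto e atTop (𝓝 ε))
    {a : ℕ → Fin k → ℝ} {L : ℕ → ℝ≥0∞} {l : ℝ≥0∞} (hL : Tendsto L atTop (𝓝 l))
    (H : ∀ n, laplaceCost h (e n) (a n) ≤ L n) : ∃ b : Fin k → ℝ, laplaceCost h ε b ≤ l := by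
  obtain ⟨α, σ, hσ, hα⟩ := CompactSpace.tendsto_subseq fun n i => (a n i : EReal)
  rw [tendsto_pi_nhds] at hα
  -- Infinite limits become `0`, the default of `toReal`. This is harmless: an escaping answer is
  -- eventually farther from any given `x` than `0` is.
  refine ⟨fun i => (α i).toReal, ?_⟩
  have hlim : ∀ x, minDisutility h x (fun i => (α i).toReal) ≤
      liminf (fun n => minDisutility h x (a (σ n))) atTop := by
    intro x
    refine le_of_forall_lt_imp_le_of_dense fun y hy => le_liminf_of_le (by isBoundedDefault) ?_
    have : ∀ i, ∀ᶠ n in atTop, y < ENNReal.ofReal (h |x - a (σ n) i|) := fun i =>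
      eventually_lt_disutility hc hm (hα i) x (hy.trans_le (iInf_le _ i))
    filter_upwards [eventually_all.2 this] with n hn
    exact le_iInf fun i => (hn i).le
  have hmeas := fun b : Fin k → ℝ => measurable_minDisutility_left hc b
  have heσ := he.comp hσ.tendsto_atTop
  calc laplaceCost h ε (fun i => (α i).toReal)
      = ∫⁻ x, ENNReal.ofReal (ε / 2 * Real.exp (-ε * |x|)) *
          minDisutility h x (fun i => (α i).toReal) := lintegral_laplaceNoise _ (hmeas _)
    _ ≤ ∫⁻ x, liminf (fun n => ENNReal.ofReal (e (σ n) / 2 * Real.exp (-e (σ n) * |x|)) *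
          minDisutility h x (a (σ n))) atTop := by
        refine lintegral_mono fun x => ?_
        have hw : Tendsto (fun n => ENNReal.ofReal (e (σ n) / 2 * Real.exp (-e (σ n) * |x|)))
            atTop (𝓝 (ENNReal.ofReal (ε / 2 * Real.exp (-ε * |x|)))) := by
          have hcont : Continuous fun t : ℝ => t / 2 * Real.exp (-t * |x|) := by fun_prop
          exact ENNReal.tendsto_ofReal ((hcont.tendsto ε).comp heσ)
        rw [← hw.liminf_eq]
        exact (mul_le_mul_right (hlim x) _).trans ENNReal.le_liminf_mul
    _ ≤ liminf (fun n => ∫⁻ x, ENNReal.ofReal (e (σ n) / 2 * Real.exp (-e (σ n) * |x|)) *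
          minDisutility h x (a (σ n))) atTop :=
        lintegral_liminf_le fun n => (by fun_prop : Measurable fun x : ℝ =>
          ENNReal.ofReal (e (σ n) / 2 * Real.exp (-e (σ n) * |x|))).mul (hmeas _)
    _ ≤ liminf (fun n => L (σ n)) atTop := by
        refine liminf_le_liminf (.of_forall fun n => ?_)
        rw [← lintegral_laplaceNoise _ (hmeas _)]
        exact H (σ n)
    _ = l := (hL.comp hσ.tendsto_atTop).liminf_eq

/-! ### The Laplace mechanism -/

theorem lintegral_laplaceAction (ε u : ℝ) {F : ℝ → ℝ≥0∞} (hF : Measurable F) :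
    ∫⁻ x, F x ∂(laplaceAction ε u) =
      ∫⁻ x, ENNReal.ofReal (ε / 2 * Real.exp (-ε * |x - u|)) * F x := by
  rw [laplaceAction, lintegral_map hF (by fun_prop), lintegral_laplaceNoise ε (by fun_prop),
    ← lintegral_add_left_eq_self
      (fun x => ENNReal.ofReal (ε / 2 * Real.exp (-ε * |x - u|)) * F x) u]
  simp

/-- A convex privacy profile dominates its tangent at `0`. -/
theorem IsPrivacyProfile.le {g : ℝ≥0 → ℝ≥0∞} {ε : ℝ} (hg : IsPrivacyProfile g ε) (t : ℝ≥0) :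
    ENNReal.ofReal ε * t ≤ g t := by
  rcases eq_or_ne t 0 with rfl | ht
  · simp
  have hlim : Tendsto (fun s : ℝ≥0 => s * t) (𝓝[≠] 0) (𝓝[≠] 0) := by
    refine tendsto_nhdsWithin_iff.2 ⟨?_, ?_⟩
    · have : Tendsto (fun s : ℝ≥0 => s * t) (𝓝 0) (𝓝 (0 * t)) :=
        (continuous_id.mul continuous_const).tendsto 0
      rw [zero_mul] at this
      exact this.mono_left nhdsWithin_le_nhds
    · filter_upwards [self_mem_nhdsWithin] with s hs
      exact mul_ne_zero hs ht
  have hlim2 := hg.deriv_zero.comp hlim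
  rw [← ENNReal.le_div_iff_mul_le (Or.inl (by exact_mod_cast ht)) (Or.inl ENNReal.coe_ne_top)]
  refine le_of_tendsto hlim2 ?_
  have h1 : ∀ᶠ s : ℝ≥0 in 𝓝[≠] 0, s < 1 :=
    nhdsWithin_le_nhds (gt_mem_nhds zero_lt_one)
  filter_upwards [self_mem_nhdsWithin, h1] with s hs hs1
  have hs' : s ≠ 0 := hs
  -- Convexity between `0` and `t` gives `g (s t) ≤ s g t`, so the quotients at `s t`, which tend to
  -- `ε`, are at most `g t / t`.
  have hconv := hg.convex.2 (Set.mem_univ t) (Set.mem_univ 0)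
    (show 0 ≤ s from zero_le) (show 0 ≤ 1 - s from zero_le) (add_tsub_cancel_of_le hs1.le)
  rw [hg.map_zero, smul_zero, smul_zero, add_zero, add_zero, smul_eq_mul, ENNReal.smul_def,
    smul_eq_mul] at hconv
  simp only [Function.comp_apply]
  rw [ENNReal.coe_mul]
  calc g (s * t) / ((s : ℝ≥0∞) * t) ≤ (s * g t) / (s * t) := ENNReal.div_le_div_right hconv _
    _ = g t / t := ENNReal.mul_div_mul_left _ _ (by exact_mod_cast hs') ENNReal.coe_ne_top

theorem isGeoPrivate_laplaceAction {g : ℝ≥0 → ℝ≥0∞} {ε : ℝ} (hg : IsPrivacyProfile g ε) :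
    IsGeoPrivate g (laplaceAction ε) where
  isProbabilityMeasure u := by
    have := isProbabilityMeasure_laplaceNoise hg.deriv_pos
    exact Measure.isProbabilityMeasure_map (by fun_prop)
  le_exp_mul u₁ u₂ hfin S hS := by
    have hε := hg.deriv_pos
    have e : ∀ u, laplaceAction ε u S =
        ∫⁻ x in S, ENNReal.ofReal (ε / 2 * Real.exp (-ε * |x - u|)) := by
      intro u
      rw [← lintegral_indicator_one hS,
        lintegral_laplaceAction ε u (measurable_one.indicator hS), ← lintegral_indicator hS]
      refine lintegral_congr fun x => ?_
      by_cases hx : x ∈ S <;> simp [hx]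
    have hle : ε * |u₁ - u₂| ≤ (g (nndist u₁ u₂)).toReal := by
      have := ENNReal.toReal_mono hfin (hg.le (nndist u₁ u₂))
      rwa [ENNReal.toReal_mul, ENNReal.toReal_ofReal hε.le, ENNReal.coe_toReal, coe_nndist,
        Real.dist_eq] at this
    rw [e, e, ← lintegral_const_mul _ (by fun_prop)]
    refine lintegral_mono fun x => ?_
    rw [← ENNReal.ofReal_mul (Real.exp_pos _).le, mul_left_comm, ← Real.exp_add]
    refine ENNReal.ofReal_le_ofReal ?_
    gcongr
    have := abs_sub_le x u₁ u₂
    nlinarith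

/-- By translation invariance all users have the same cost. The sign of `a` flips because the noise
moves the signal rather than the user. -/
theorem mechanismCost_laplaceAction {h : ℝ → ℝ} (hc : ContinuousOn h (Set.Ici 0)) {k : ℕ} (ε : ℝ)
    (a : Fin k → ℝ) :
    mechanismCost h (laplaceAction ε) (shiftResponse a) = laplaceCost h ε (-a) := by
  have e : ∀ u, ∫⁻ s, ∫⁻ b, minDisutility h u b ∂(shiftResponse a s) ∂(laplaceAction ε u) =
      laplaceCost h ε (-a) := by
    intro u
    have hmeas : ∀ u, Measurable fun b : Fin k → ℝ => minDisutility h u b := by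
      intro u
      have : Measurable fun a : Fin k → ℝ => (u, a) := by fun_prop
      have h3 := (measurable_minDisutility hc k).comp this
      exact h3
    have hs : Measurable fun s : ℝ => minDisutility h u fun i => s + a i := by
      have : Measurable fun (s : ℝ) (i : Fin k) => s + a i := by fun_prop
      exact (hmeas u).comp this
    have e1 : ∀ s, ∫⁻ b, minDisutility h u b ∂(shiftResponse a s) =
        minDisutility h u fun i => s + a i := fun s => by
      rw [shiftResponse, Kernel.lintegral_deterministic' _ (hmeas u)]
    simp_rw [e1]
    rw [laplaceAction, lintegral_map hs (by fun_prop), laplaceCost]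
    refine lintegral_congr fun x => ?_
    unfold minDisutility
    congr 1
    funext i
    rw [Pi.neg_apply, ← abs_neg (x - -a i)]
    ring_nf
  rw [mechanismCost]
  simp_rw [e, ciSup_const]

theorem isMarkovKernel_shiftResponse {k : ℕ} (a : Fin k → ℝ) :
    IsMarkovKernel (shiftResponse a) := by
  unfold shiftResponse
  infer_instance

/-- The signal space `ℝ` is admissible in every universe. -/
theorem optimalCost_le_mechanismCost {h : ℝ → ℝ} (hc : ContinuousOn h (Set.Ici 0))
    {g : ℝ≥0 → ℝ≥0∞} {k : ℕ} {P : ℝ → Measure ℝ} (hP : IsGeoPrivate g P)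
    (Q : Kernel ℝ (Fin k → ℝ)) [IsMarkovKernel Q] :
    optimalCost.{v} h g k ≤ mechanismCost h P Q := by
  have hup : Measurable (ULift.up : ℝ → ULift.{v} ℝ) := measurable_up
  have hdown : Measurable (ULift.down : ULift.{v} ℝ → ℝ) := measurable_down
  have hP' : IsGeoPrivate g fun u => (P u).map (ULift.up : ℝ → ULift.{v} ℝ) :=
    { isProbabilityMeasure := fun u => by
        have := hP.isProbabilityMeasure u
        exact Measure.isProbabilityMeasure_map hup.aemeasurable
      le_exp_mul := fun u₁ u₂ hfin S hS => by
        rw [Measure.map_apply hup hS, Measure.map_apply hup hS]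
        exact hP.le_exp_mul u₁ u₂ hfin _ (hup hS) }
  have hQ' : IsMarkovKernel (Q.comap (ULift.down : ULift.{v} ℝ → ℝ) hdown) := inferInstance
  calc optimalCost.{v} h g k
      ≤ mechanismCost h (fun u => (P u).map (ULift.up : ℝ → ULift.{v} ℝ))
        (Q.comap ULift.down hdown) :=
        iInf_le_of_le (ULift.{v} ℝ) <| iInf_le_of_le inferInstance <| iInf_le_of_le _ <|
          iInf_le_of_le hP' <| iInf_le_of_le _ <| iInf_le _ hQ'
    _ = mechanismCost h P Q := by
        unfold mechanismCost
        congr 1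
        funext u
        have hGm := measurable_expected_minDisutility hc (Q.comap ULift.down hdown)
        have hu : Measurable fun s : ULift.{v} ℝ => (u, s) := by fun_prop
        have h3 := hGm.comp hu
        exact lintegral_map h3 hup

/-- The optimal cost is the least expected disutility under Laplace noise. -/
theorem exists_laplaceCost_eq_optimalCost {h : ℝ → ℝ} (hc : ContinuousOn h (Set.Ici 0))
    (hm : MonotoneOn h (Set.Ici 0)) {g : ℝ≥0 → ℝ≥0∞} {ε : ℝ} (hg : IsPrivacyProfile g ε) {k : ℕ}
    (hk : 0 < k) : ∃ a : Fin k → ℝ, laplaceCost h ε a = optimalCost.{v} h g k := by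
  have hε := hg.deriv_pos
  have upper : ∀ a : Fin k → ℝ, optimalCost.{v} h g k ≤ laplaceCost h ε a := by
    intro a
    have := isMarkovKernel_shiftResponse (-a)
    have h1 := optimalCost_le_mechanismCost.{v} hc (isGeoPrivate_laplaceAction hg)
      (shiftResponse (-a))
    rwa [mechanismCost_laplaceAction hc, neg_neg] at h1
  -- One `δ` comes from replacing `g` by a linear profile, the other from the prior on the users.
  have lower : ∀ δ : ℝ, 0 < δ →
      ⨅ a : Fin k → ℝ, laplaceCost h (ε + δ + δ) a ≤ optimalCost.{v} h g k := by
    intro δ hδ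
    refine le_iInf fun Z => le_iInf fun _ => le_iInf fun P => le_iInf fun hP => le_iInf fun Q =>
      le_iInf fun _ => ?_
    have := hP.isProbabilityMeasure
    exact le_mechanismCost hc hm (add_pos hε hδ) hδ hk (fun b _ => iInf_le _ b)
      (fun u v S hS => hP.le_exp_add_mul hg hδ u v hS) Q
  rcases eq_or_ne (optimalCost.{v} h g k) ∞ with htop | hfin
  · exact ⟨0, le_antisymm (by rw [htop]; exact le_top) (upper 0)⟩
  have hnear : ∀ n : ℕ, ∃ a : Fin k → ℝ,
      laplaceCost h (ε + 1 / ((n : ℝ) + 1) + 1 / ((n : ℝ) + 1)) a ≤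
        optimalCost.{v} h g k + ((n : ℝ≥0∞) + 1)⁻¹ := by
    intro n
    have h1 := lower (1 / ((n : ℝ) + 1)) (by positivity)
    have h2 : ⨅ a : Fin k → ℝ, laplaceCost h (ε + 1 / ((n : ℝ) + 1) + 1 / ((n : ℝ) + 1)) a <
        optimalCost.{v} h g k + ((n : ℝ≥0∞) + 1)⁻¹ :=
      h1.trans_lt (ENNReal.lt_add_right hfin (by simp))
    obtain ⟨a, ha⟩ := iInf_lt_iff.1 h2
    exact ⟨a, ha.le⟩
  choose a ha using hnear
  have he : Tendsto (fun n : ℕ => ε + 1 / ((n : ℝ) + 1) + 1 / ((n : ℝ) + 1)) atTop (𝓝 ε) := by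
    have := (tendsto_one_div_add_atTop_nhds_zero_nat (𝕜 := ℝ))
    simpa using (this.const_add ε).add this
  have hL : Tendsto (fun n : ℕ => optimalCost.{v} h g k + ((n : ℝ≥0∞) + 1)⁻¹) atTop
      (𝓝 (optimalCost.{v} h g k)) := by
    have h1 : Tendsto (fun n : ℕ => (((n + 1 : ℕ) : ℝ≥0∞))⁻¹) atTop (𝓝 0) :=
      ENNReal.tendsto_inv_nat_nhds_zero.comp (tendsto_add_atTop_nat 1)
    push_cast at h1
    simpa using h1.const_add (optimalCost.{v} h g k)
  obtain ⟨b, hb⟩ := exists_laplaceCost_le hc hm he hL ha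
  exact ⟨b, le_antisymm hb (upper b)⟩

/-! ### Linear disutility: exponential tails of the distance to a finite set -/

/-- Memorylessness of the exponential law, the source of the recursion on the number of answers. -/
theorem expTail_split {ε c c' : ℝ} (hc : c ≤ c') (F : ℝ → ℝ≥0∞) :
    expTail ε c F = (∫⁻ x in Set.Ioc c c', ENNReal.ofReal (ε * Real.exp (-ε * (x - c))) * F x) +
      ENNReal.ofReal (Real.exp (-ε * (c' - c))) * expTail ε c' F := by
  rw [expTail, ← Set.Ioc_union_Ioi_eq_Ioi hc, lintegral_union measurableSet_Ioi
    (Set.disjoint_left.2 fun x h1 h2 => not_lt.2 h1.2 h2), expTail,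
    ← lintegral_const_mul' _ _ ENNReal.ofReal_ne_top]
  congr 1
  refine lintegral_congr fun x => ?_
  rw [← mul_assoc, ← ENNReal.ofReal_mul (Real.exp_pos _).le, mul_left_comm, ← Real.exp_add]
  ring_nf

theorem lintegral_Ioc_eq_of_hasDerivAt {f f' : ℝ → ℝ} {a b : ℝ} (hab : a ≤ b)
    (hf : ∀ x, HasDerivAt f (f' x) x) (hc : Continuous f') (hpos : ∀ x, a < x → x ≤ b → 0 ≤ f' x) :
    ∫⁻ x in Set.Ioc a b, ENNReal.ofReal (f' x) = ENNReal.ofReal (f b - f a) := by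
  rw [← intervalIntegral.integral_eq_sub_of_hasDerivAt (fun x _ => hf x)
    (hc.intervalIntegrable a b), intervalIntegral.integral_of_le hab,
    ofReal_integral_eq_lintegral_ofReal hc.integrableOn_Ioc]
  exact (ae_restrict_mem measurableSet_Ioc).mono fun x hx => hpos x hx.1 hx.2

theorem lintegral_Ioc_exp_mul_sub_right {ε : ℝ} (hε : 0 < ε) (c : ℝ) {d : ℝ} (hd : 0 ≤ d) :
    ∫⁻ x in Set.Ioc c (c + d), ENNReal.ofReal (ε * Real.exp (-ε * (x - c))) *
      ENNReal.ofReal (c + d - x) = ENNReal.ofReal (d - (1 - Real.exp (-ε * d)) / ε) := by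
  have h1 : ∀ x, HasDerivAt (fun x => (-(c + d - x) + 1 / ε) * Real.exp (-ε * (x - c)))
      (ε * Real.exp (-ε * (x - c)) * (c + d - x)) x := by
    intro x
    have h2 : HasDerivAt (fun x => -(c + d - x) + 1 / ε) 1 x := by
      simpa using (((hasDerivAt_id x).const_sub (c + d)).neg).add_const (1 / ε)
    have h3 : HasDerivAt (fun x => Real.exp (-ε * (x - c))) (Real.exp (-ε * (x - c)) * (-ε)) x := by
      simpa using (((hasDerivAt_id x).sub_const c).const_mul (-ε)).exp
    refine (h2.mul h3).congr_deriv ?_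
    field_simp
    ring
  have h4 := lintegral_Ioc_eq_of_hasDerivAt (show c ≤ c + d by linarith) h1 (by fun_prop)
    fun x _ hx => mul_nonneg (by positivity) (by linarith)
  simp_rw [← ENNReal.ofReal_mul (mul_pos hε (Real.exp_pos _)).le]
  rw [h4]
  congr 1
  simp only [add_sub_cancel_left, sub_self, mul_zero, Real.exp_zero]
  field_simp
  ring

theorem hasDerivAt_neg_mul_exp {ε : ℝ} (hε : 0 < ε) (c x : ℝ) :
    HasDerivAt (fun x => -(x - c + 1 / ε) * Real.exp (-ε * (x - c)))
      (ε * Real.exp (-ε * (x - c)) * (x - c)) x := by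
  have h2 : HasDerivAt (fun x => -(x - c + 1 / ε)) (-1) x :=
    (((hasDerivAt_id x).sub_const c).add_const (1 / ε)).neg
  have h3 : HasDerivAt (fun x => Real.exp (-ε * (x - c))) (Real.exp (-ε * (x - c)) * (-ε)) x := by
    simpa using (((hasDerivAt_id x).sub_const c).const_mul (-ε)).exp
  refine (h2.mul h3).congr_deriv ?_
  field_simp
  ring

theorem lintegral_Ioc_exp_mul_sub_left {ε : ℝ} (hε : 0 < ε) (c : ℝ) {s : ℝ} (hs : 0 ≤ s) :
    ∫⁻ x in Set.Ioc c (c + s), ENNReal.ofReal (ε * Real.exp (-ε * (x - c))) *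
      ENNReal.ofReal (x - c) =
      ENNReal.ofReal (1 / ε - (s + 1 / ε) * Real.exp (-ε * s)) := by
  have h4 := lintegral_Ioc_eq_of_hasDerivAt (show c ≤ c + s by linarith)
    (hasDerivAt_neg_mul_exp hε c) (by fun_prop)
    fun x hx _ => mul_nonneg (by positivity) (by linarith)
  simp_rw [← ENNReal.ofReal_mul (mul_pos hε (Real.exp_pos _)).le]
  rw [h4]
  congr 1
  simp only [add_sub_cancel_left, sub_self, mul_zero, Real.exp_zero]
  ring

theorem expTail_sub {ε : ℝ} (hε : 0 < ε) (c : ℝ) :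
    expTail ε c (fun x => ENNReal.ofReal (x - c)) = ENNReal.ofReal (1 / ε) := by
  have hlim : Tendsto (fun x => -(x - c + 1 / ε) * Real.exp (-ε * (x - c))) atTop (𝓝 0) := by
    have h0 : Tendsto (fun x => ε * (x - c)) atTop atTop :=
      (tendsto_atTop_add_const_right _ (-c) tendsto_id).const_mul_atTop hε
    have h1 := (Real.tendsto_pow_mul_exp_neg_atTop_nhds_zero 1).comp h0
    have h2 := (Real.tendsto_pow_mul_exp_neg_atTop_nhds_zero 0).comp h0
    have h3 := (h1.add h2).const_mul (-1 / ε)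
    simp only [add_zero, mul_zero] at h3
    refine h3.congr fun x => ?_
    simp only [Function.comp_apply, pow_one, pow_zero, neg_mul]
    field_simp
  have hpos : ∀ x ∈ Set.Ioi c, 0 ≤ ε * Real.exp (-ε * (x - c)) * (x - c) := fun x hx =>
    mul_nonneg (by positivity) (sub_nonneg.2 (Set.mem_Ioi.1 hx).le)
  have hint := integrableOn_Ioi_deriv_of_nonneg' (fun x _ => hasDerivAt_neg_mul_exp hε c x)
    hpos hlim
  have hval := integral_Ioi_of_hasDerivAt_of_nonneg' (fun x _ => hasDerivAt_neg_mul_exp hε c x)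
    hpos hlim
  rw [expTail]
  simp_rw [← ENNReal.ofReal_mul (mul_pos hε (Real.exp_pos _)).le]
  rw [← ofReal_integral_eq_lintegral_ofReal hint
    ((ae_restrict_mem measurableSet_Ioi).mono hpos), hval]
  congr 1
  simp

/-! ### Half-line lower bounds, by recursion on the number of answers. -/

theorem ofReal_le_infEDist {x r : ℝ} {S : Set ℝ} (h : ∀ y ∈ S, r ≤ |x - y|) :
    ENNReal.ofReal r ≤ Metric.infEDist x S :=
  Metric.le_infEDist.2 fun y hy => by
    rw [edist_dist, Real.dist_eq]
    exact ENNReal.ofReal_le_ofReal (h y hy)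

theorem infEDist_le_ofReal {x y r : ℝ} {S : Set ℝ} (hy : y ∈ S) (h : |x - y| ≤ r) :
    Metric.infEDist x S ≤ ENNReal.ofReal r := by
  refine (Metric.infEDist_le_edist_of_mem hy).trans ?_
  rw [edist_dist, Real.dist_eq]
  exact ENNReal.ofReal_le_ofReal h

theorem infEDist_le_infEDist_of_forall_exists {x : ℝ} {S T : Set ℝ}
    (h : ∀ y ∈ S, ∃ z ∈ T, |x - z| ≤ |x - y|) : Metric.infEDist x T ≤ Metric.infEDist x S :=
  Metric.le_infEDist.2 fun y hy => by
    obtain ⟨z, hz, hzy⟩ := h y hy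
    rw [edist_dist, Real.dist_eq]
    exact infEDist_le_ofReal hz hzy

/-- Minimises over the scaled distance `x` to the first answer; equality at `x = log r`. -/
theorem log_le_gap_add (x : ℝ) {r : ℝ} (hr : 0 < r) :
    Real.log r ≤ x - 1 + Real.exp (-x) * r := by
  have h := Real.add_one_le_exp (Real.log r - x)
  rw [sub_eq_add_neg, Real.exp_add, Real.exp_log hr] at h
  linarith

/-- Minimises over the scaled half-gap `x` between consecutive answers; equality again at `x = log
r`. -/
theorem one_sub_inv_le_gap_add (x : ℝ) {r : ℝ} (hr : 0 < r) :
    1 - 1 / r ≤ 1 - (x + 1) * Real.exp (-x) + Real.exp (-x) * Real.log r := by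
  have h := Real.add_one_le_exp (x - Real.log r)
  have h1 : Real.exp (x - Real.log r) * Real.exp (-x) = 1 / r := by
    rw [← Real.exp_add, show x - Real.log r + -x = -Real.log r by ring, Real.exp_neg,
      Real.exp_log hr, one_div]
  have h2 := mul_le_mul_of_nonneg_right h (Real.exp_pos (-x)).le
  rw [h1] at h2
  linarith

/-- With answers to the right of `c` only, the first one at distance `d`. -/
theorem le_expTail_of_first {ε : ℝ} (hε : 0 < ε) {c b : ℝ} (hcb : c ≤ b) {S : Set ℝ}
    (hS : ∀ y ∈ S, b ≤ y) (m : ℕ)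
    (h : ENNReal.ofReal (1 / ((m + 1) * ε)) ≤ expTail ε b fun x => Metric.infEDist x S) :
    ENNReal.ofReal (Real.log ((m + 2) / (m + 1)) / ε) ≤
      expTail ε c fun x => Metric.infEDist x S := by
  rw [expTail_split hcb]
  have e := lintegral_Ioc_exp_mul_sub_right hε c (sub_nonneg.2 hcb)
  rw [add_sub_cancel] at e
  calc ENNReal.ofReal (Real.log ((m + 2) / (m + 1)) / ε)
      ≤ ENNReal.ofReal ((b - c) - (1 - Real.exp (-ε * (b - c))) / ε +
          Real.exp (-ε * (b - c)) * (1 / ((m + 1) * ε))) := by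
        refine ENNReal.ofReal_le_ofReal ?_
        have h1 := log_le_gap_add (ε * (b - c)) (r := ((m : ℝ) + 2) / (m + 1)) (by positivity)
        rw [div_le_iff₀ hε]
        refine h1.trans_eq ?_
        rw [neg_mul]
        field_simp
        ring
    _ ≤ _ := by
        refine ENNReal.ofReal_add_le.trans (add_le_add ?_ ?_)
        · rw [← e]
          refine setLIntegral_mono' measurableSet_Ioc fun x hx => ?_
          gcongr
          refine ofReal_le_infEDist fun y hy => ?_
          have := hS y hy
          rw [abs_sub_comm]
          exact le_trans (by linarith) (le_abs_self _)
        · rw [ENNReal.ofReal_mul (Real.exp_pos _).le]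
          gcongr

/-- With an answer at `c`, the next one at distance `2 s`. -/
theorem le_expTail_of_midpoint {ε : ℝ} (hε : 0 < ε) {c s : ℝ} (hs : 0 ≤ s) {S : Set ℝ}
    (hS : ∀ y ∈ S, y ≤ c ∨ c + 2 * s ≤ y) (m : ℕ)
    (h : ENNReal.ofReal (Real.log ((m + 2) / (m + 1)) / ε) ≤
      expTail ε (c + s) fun x => Metric.infEDist x S) :
    ENNReal.ofReal (1 / ((m + 2) * ε)) ≤ expTail ε c fun x => Metric.infEDist x S := by
  rw [expTail_split (show c ≤ c + s by linarith), add_sub_cancel_left]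
  calc ENNReal.ofReal (1 / ((m + 2) * ε))
      ≤ ENNReal.ofReal (1 / ε - (s + 1 / ε) * Real.exp (-ε * s) +
          Real.exp (-ε * s) * (Real.log ((m + 2) / (m + 1)) / ε)) := by
        refine ENNReal.ofReal_le_ofReal ?_
        have h1 := one_sub_inv_le_gap_add (ε * s) (r := ((m : ℝ) + 2) / (m + 1)) (by positivity)
        have h2 : 1 / ((m + 2) * ε) = (1 - 1 / (((m : ℝ) + 2) / (m + 1))) / ε := by
          field_simp
          ring
        rw [h2, div_le_iff₀ hε]
        refine h1.trans_eq ?_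
        rw [neg_mul]
        field_simp
    _ ≤ _ := by
        refine ENNReal.ofReal_add_le.trans (add_le_add ?_ ?_)
        · rw [← lintegral_Ioc_exp_mul_sub_left hε c hs]
          refine setLIntegral_mono' measurableSet_Ioc fun x hx => ?_
          gcongr
          refine ofReal_le_infEDist fun y hy => ?_
          rcases hS y hy with hy | hy
          · exact le_trans (by linarith) (le_abs_self _)
          · rw [abs_sub_comm]
            exact le_trans (by linarith [hx.2]) (le_abs_self _)
        · rw [ENNReal.ofReal_mul (Real.exp_pos _).le]
          gcongr

/-- The least answer comes first and at most `m` others lie beyond it, so `ih` applies from there.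
With `ih` as a hypothesis the lemma serves both inside the induction and for even `k`. -/
theorem le_expTail_infEDist_of_forall_le {ε : ℝ} (hε : 0 < ε) (m : ℕ)
    (ih : ∀ (c : ℝ) (S : Finset ℝ), (S.filter (c < ·)).card ≤ m →
      ENNReal.ofReal (1 / ((m + 1) * ε)) ≤ expTail ε c fun x => Metric.infEDist x (S : Set ℝ))
    (c : ℝ) {S : Finset ℝ} (hne : S.Nonempty) (hc : ∀ y ∈ S, c ≤ y) (hS : S.card ≤ m + 1) :
    ENNReal.ofReal (Real.log ((m + 2) / (m + 1)) / ε) ≤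
      expTail ε c fun x => Metric.infEDist x (S : Set ℝ) := by
  refine le_expTail_of_first hε (hc _ (S.min'_mem hne))
    (fun y hy => S.min'_le y (by exact_mod_cast hy)) m (ih _ S ?_)
  have h1 : S.filter (S.min' hne < ·) ⊆ S.erase (S.min' hne) := fun y hy => by
    rw [Finset.mem_filter] at hy
    exact Finset.mem_erase.2 ⟨hy.2.ne', hy.1⟩
  have h2 := Finset.card_le_card h1
  rw [Finset.card_erase_of_mem (S.min'_mem hne)] at h2
  omega

/-- Lower bound with at most `m` answers to the right of `c`. -/
theorem le_expTail_infEDist {ε : ℝ} (hε : 0 < ε) (m : ℕ) (c : ℝ) (S : Finset ℝ)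
    (hS : (S.filter (c < ·)).card ≤ m) :
    ENNReal.ofReal (1 / ((m + 1) * ε)) ≤ expTail ε c fun x => Metric.infEDist x (S : Set ℝ) := by
  have hempty : ∀ (m : ℕ) (c : ℝ) (S : Finset ℝ), S.filter (c < ·) = ∅ →
      ENNReal.ofReal (1 / ((m + 1) * ε)) ≤
        expTail ε c fun x => Metric.infEDist x (S : Set ℝ) := by
    intro m c S h
    refine le_trans ?_ ((expTail_sub hε c).symm.le.trans (expTail_mono fun x hx => ?_))
    · refine ENNReal.ofReal_le_ofReal ?_
      refine one_div_le_one_div_of_le hε ?_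
      have : (0 : ℝ) ≤ m := m.cast_nonneg
      nlinarith
    · refine ofReal_le_infEDist fun y hy => ?_
      have hyc : ¬ c < y := Finset.filter_eq_empty_iff.1 h (by exact_mod_cast hy)
      exact le_trans (by linarith) (le_abs_self _)
  induction m generalizing c S with
  | zero => exact hempty 0 c S (Finset.card_eq_zero.1 (Nat.le_zero.1 hS))
  | succ m ih =>
    rcases Finset.eq_empty_or_nonempty (S.filter (c < ·)) with h | hne
    · exact hempty _ c S h
    set T := S.filter (c < ·) with hT
    have hb := T.min'_mem hne
    set b := T.min' hne with hbdef
    have hcb : c < b := (Finset.mem_filter.1 hb).2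
    have hdich : ∀ y ∈ S, y ≤ c ∨ y ∈ T := fun y hy => by
      rcases le_or_gt y c with h | h
      · exact Or.inl h
      · exact Or.inr (Finset.mem_filter.2 ⟨hy, h⟩)
    -- Beyond the midpoint of `c` and `b`, answers at or left of `c` are no closer than `b`, so only
    -- `T` counts.
    have hV := le_expTail_infEDist_of_forall_le hε m ih (c + (b - c) / 2) hne
      (fun y hy => by have := T.min'_le y hy; linarith) hS
    have key := le_expTail_of_midpoint hε (c := c) (s := (b - c) / 2) (by linarith)
      (S := (S : Set ℝ)) (fun y hy => (hdich y (by exact_mod_cast hy)).imp id fun hy => by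
        have := T.min'_le y hy; linarith) m
      (hV.trans (expTail_mono fun x hx => infEDist_le_infEDist_of_forall_exists fun y hy => ?_))
    · push_cast
      rwa [show (m : ℝ) + 1 + 1 = m + 2 by ring]
    · rcases hdich y (by exact_mod_cast hy) with h | h
      · refine ⟨b, by exact_mod_cast hb, ?_⟩
        rw [abs_of_nonneg (show 0 ≤ x - y by linarith), abs_le]
        constructor <;> linarith
      · exact ⟨y, by exact_mod_cast h, le_rfl⟩

/-! ### Attainment of the half-line bounds. -/

/-- Equality case of `log_le_gap_add`. Membership of the required points suffices, since further
points of `S` only reduce the distance. -/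
theorem expTail_le_of_mem_first {ε : ℝ} (hε : 0 < ε) (m : ℕ) {c : ℝ} {S : Set ℝ}
    (hb : c + Real.log ((m + 2) / (m + 1)) / ε ∈ S)
    (h : (expTail ε (c + Real.log ((m + 2) / (m + 1)) / ε) fun x => Metric.infEDist x S) ≤
      ENNReal.ofReal (1 / ((m + 1) * ε))) :
    (expTail ε c fun x => Metric.infEDist x S) ≤
      ENNReal.ofReal (Real.log ((m + 2) / (m + 1)) / ε) := by
  have hr : (0 : ℝ) < (m + 2) / (m + 1) := by positivity
  have hlog : 0 ≤ Real.log (((m : ℝ) + 2) / (m + 1)) :=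
    Real.log_nonneg ((one_le_div (by positivity)).2 (by linarith))
  set d := Real.log (((m : ℝ) + 2) / (m + 1)) / ε with hd
  have hd0 : 0 ≤ d := by positivity
  have hεd : ε * d = Real.log (((m : ℝ) + 2) / (m + 1)) := by rw [hd]; field_simp
  have hexp : Real.exp (-ε * d) = ((m : ℝ) + 1) / (m + 2) := by
    rw [neg_mul, hεd, Real.exp_neg, Real.exp_log hr, inv_div]
  rw [expTail_split (show c ≤ c + d by linarith), add_sub_cancel_left]
  calc _ ≤ ENNReal.ofReal (d - (1 - Real.exp (-ε * d)) / ε) +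
        ENNReal.ofReal (Real.exp (-ε * d)) * ENNReal.ofReal (1 / ((m + 1) * ε)) := by
        rw [← lintegral_Ioc_exp_mul_sub_right hε c hd0]
        refine add_le_add (setLIntegral_mono' measurableSet_Ioc fun x hx => ?_) (by gcongr)
        gcongr
        refine infEDist_le_ofReal hb ?_
        rw [abs_sub_comm, abs_of_nonneg (by linarith [hx.2])]
    _ = ENNReal.ofReal d := by
        rw [← ENNReal.ofReal_mul (Real.exp_pos _).le, ← ENNReal.ofReal_add]
        · congr 1
          rw [hexp]
          field_simp
          ring
        · rw [sub_nonneg, div_le_iff₀ hε]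
          have := Real.add_one_le_exp (-ε * d)
          linarith
        · positivity

/-- Equality case of `one_sub_inv_le_gap_add`, the half-gap being the same length as the first
distance. -/
theorem expTail_le_of_mem_midpoint {ε : ℝ} (hε : 0 < ε) (m : ℕ) {c : ℝ} {S : Set ℝ} (hc : c ∈ S)
    (h : (expTail ε (c + Real.log ((m + 2) / (m + 1)) / ε) fun x => Metric.infEDist x S) ≤
      ENNReal.ofReal (Real.log ((m + 2) / (m + 1)) / ε)) :
    (expTail ε c fun x => Metric.infEDist x S) ≤ ENNReal.ofReal (1 / ((m + 2) * ε)) := by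
  have hr : (0 : ℝ) < (m + 2) / (m + 1) := by positivity
  have hlog : 0 ≤ Real.log (((m : ℝ) + 2) / (m + 1)) :=
    Real.log_nonneg ((one_le_div (by positivity)).2 (by linarith))
  set s := Real.log (((m : ℝ) + 2) / (m + 1)) / ε with hs
  have hs0 : 0 ≤ s := by positivity
  have hεs : ε * s = Real.log (((m : ℝ) + 2) / (m + 1)) := by rw [hs]; field_simp
  have hexp : Real.exp (-ε * s) = ((m : ℝ) + 1) / (m + 2) := by
    rw [neg_mul, hεs, Real.exp_neg, Real.exp_log hr, inv_div]
  rw [expTail_split (show c ≤ c + s by linarith), add_sub_cancel_left]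
  calc _ ≤ ENNReal.ofReal (1 / ε - (s + 1 / ε) * Real.exp (-ε * s)) +
        ENNReal.ofReal (Real.exp (-ε * s)) * ENNReal.ofReal s := by
        rw [← lintegral_Ioc_exp_mul_sub_left hε c hs0]
        refine add_le_add (setLIntegral_mono' measurableSet_Ioc fun x hx => ?_) (by gcongr)
        gcongr
        refine infEDist_le_ofReal hc ?_
        rw [abs_of_nonneg (by linarith [hx.1])]
    _ = ENNReal.ofReal (1 / ((m + 2) * ε)) := by
        rw [← ENNReal.ofReal_mul (Real.exp_pos _).le, ← ENNReal.ofReal_add]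
        · congr 1
          rw [hexp]
          field_simp
          ring
        · have h1 := Real.add_one_le_exp (ε * s)
          have h2 : Real.exp (ε * s) * Real.exp (-ε * s) = 1 := by rw [← Real.exp_add]; simp
          have h3 := mul_le_mul_of_nonneg_right h1 (Real.exp_pos (-ε * s)).le
          rw [h2] at h3
          rw [sub_nonneg, le_div_iff₀ hε]
          refine le_trans (le_of_eq ?_) h3
          field_simp
        · positivity

theorem expTail_infEDist_le_of_forall_le {ε : ℝ} (hε : 0 < ε) (m : ℕ)
    (ih : ∀ (c : ℝ) (S : Set ℝ),
      (∀ j : ℕ, 1 ≤ j → j ≤ m + 1 → c + 2 * Real.log ((m + 1) / j) / ε ∈ S) →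
      (expTail ε c fun x => Metric.infEDist x S) ≤ ENNReal.ofReal (1 / ((m + 1) * ε)))
    {c : ℝ} {S : Set ℝ} (hS : ∀ j : ℕ, 1 ≤ j → j ≤ m + 1 →
      c + Real.log ((m + 1) * (m + 2) / (j : ℝ) ^ 2) / ε ∈ S) :
    (expTail ε c fun x => Metric.infEDist x S) ≤
      ENNReal.ofReal (Real.log ((m + 2) / (m + 1)) / ε) := by
  refine expTail_le_of_mem_first hε m ?_ (ih _ _ fun j h1 h2 => ?_)
  · have := hS (m + 1) (by omega) le_rfl
    push_cast at this
    rwa [show ((m : ℝ) + 1) * (m + 2) / (m + 1) ^ 2 = (m + 2) / (m + 1) by field_simp] at this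
  · have hj : (0 : ℝ) < j := by exact_mod_cast h1
    have := hS j h1 h2
    rwa [show ((m : ℝ) + 1) * (m + 2) / (j : ℝ) ^ 2 = (m + 2) / (m + 1) * ((m + 1) / j) ^ 2 by
      field_simp, Real.log_mul (by positivity) (by positivity), Real.log_pow, add_div,
      ← add_assoc] at this

/-- The closed-form points attain the lower bound. -/
theorem expTail_infEDist_le {ε : ℝ} (hε : 0 < ε) (m : ℕ) (c : ℝ) (S : Set ℝ)
    (hS : ∀ j : ℕ, 1 ≤ j → j ≤ m + 1 → c + 2 * Real.log ((m + 1) / j) / ε ∈ S) :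
    (expTail ε c fun x => Metric.infEDist x S) ≤ ENNReal.ofReal (1 / ((m + 1) * ε)) := by
  have hmem : c ∈ S := by
    have := hS (m + 1) (by omega) le_rfl
    push_cast at this
    rwa [div_self (by positivity), Real.log_one, mul_zero, zero_div, add_zero] at this
  induction m generalizing c S with
  | zero =>
    simp only [Nat.cast_zero, zero_add, one_mul]
    rw [← expTail_sub hε c]
    refine expTail_mono fun x hx => infEDist_le_ofReal hmem ?_
    rw [abs_of_nonneg (by linarith)]
  | succ m ih =>
    have key := expTail_le_of_mem_midpoint hε m hmem
      (expTail_infEDist_le_of_forall_le hε m (fun c S h => ih c S h ?_) fun j h1 h2 => ?_)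
    · push_cast
      rwa [show (m : ℝ) + 1 + 1 = m + 2 by ring]
    · have := h (m + 1) (by omega) le_rfl
      push_cast at this
      rwa [div_self (by positivity), Real.log_one, mul_zero, zero_div, add_zero] at this
    · have hj : (0 : ℝ) < j := by exact_mod_cast h1
      have := hS j h1 (by omega)
      push_cast at this
      -- The half-gap `log ((m + 2) / (m + 1))` turns the point list seen from the midpoint into the
      -- list seen from `c`.
      have e : 2 * Real.log (((m : ℝ) + 1 + 1) / j) =
          Real.log ((m + 2) / (m + 1)) + Real.log ((m + 1) * (m + 2) / (j : ℝ) ^ 2) := by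
        rw [← Real.log_mul (by positivity) (by positivity), ← Nat.cast_two, ← Real.log_pow]
        congr 1
        push_cast
        field_simp
        ring
      rwa [e, add_div, ← add_assoc] at this

/-! ### Linear disutility: optimal answers -/

theorem minDisutility_id {k : ℕ} (u : ℝ) (a : Fin k → ℝ) :
    minDisutility (fun z => z) u a = Metric.infEDist u (Set.range a) := by
  rw [minDisutility, Metric.infEDist, iInf_range]
  simp_rw [edist_dist, Real.dist_eq]

theorem laplaceCost_id_eq (ε : ℝ) {k : ℕ} (a : Fin k → ℝ) :
    laplaceCost (fun z => z) ε a = ((expTail ε 0 fun x => Metric.infEDist x (Set.range a)) +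
      expTail ε 0 fun x => Metric.infEDist x (Set.range (-a))) / 2 := by
  rw [laplaceCost, lintegral_laplaceNoise_eq_expTail ε
    (measurable_minDisutility_left (h := fun z => z) continuousOn_id a)]
  simp_rw [minDisutility_neg, minDisutility_id]

theorem add_div_two_le {x y l : ℝ≥0∞} (hx : x ≤ l) (hy : y ≤ l) : (x + y) / 2 ≤ l := by
  refine (ENNReal.div_le_div_right (add_le_add hx hy) 2).trans ?_
  rw [← two_mul, mul_comm, ENNReal.mul_div_cancel_right (by norm_num) (by norm_num)]

theorem IsSymmetricList.laplaceCost_id_eq {k : ℕ} {b : Fin k → ℝ} (hb : IsSymmetricList b)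
    (ε : ℝ) : laplaceCost (fun z => z) ε b =
      expTail ε 0 fun x => Metric.infEDist x (Set.range b) := by
  have e : Set.range (-b) = Set.range b := by
    have : (-b) = b ∘ Fin.rev := funext fun i => by simp [hb.rev]
    rw [this, Fin.rev_surjective.range_comp]
  rw [_root_.laplaceCost_id_eq, e, ← two_mul, mul_comm,
    ENNReal.mul_div_cancel_right (by norm_num) (by norm_num)]

theorem IsSymmetricList.le_laplaceCost_odd {t : ℕ} {b : Fin (2 * t + 1) → ℝ}
    (hb : IsSymmetricList b) {ε : ℝ} (hε : 0 < ε) :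
    ENNReal.ofReal (1 / ((t + 1) * ε)) ≤ laplaceCost (fun z => z) ε b := by
  rw [hb.laplaceCost_id_eq]
  have hcard : ((Finset.univ.image b).filter (0 < ·)).card ≤ t := by
    have hsub : (Finset.univ.image b).filter (0 < ·) ⊆
        (Finset.Ioi (⟨t, by omega⟩ : Fin (2 * t + 1))).image b := by
      intro y hy
      obtain ⟨hy1, hy0⟩ := Finset.mem_filter.1 hy
      obtain ⟨i, -, rfl⟩ := Finset.mem_image.1 hy1
      refine Finset.mem_image.2 ⟨i, ?_, rfl⟩
      rw [Finset.mem_Ioi, Fin.lt_def]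
      by_contra hcon
      have := hb.nonneg i.rev (by rw [Fin.val_rev]; simp only at hcon; omega)
      rw [hb.rev] at this
      linarith
    refine (Finset.card_le_card hsub).trans (Finset.card_image_le.trans ?_)
    rw [Fin.card_Ioi]
    simp only
    omega
  have := le_expTail_infEDist hε t 0 _ hcard
  simpa using this

/-- For a user on the positive side the mirror image of a nonpositive answer is at least as close,
so the `t + 1` answers of the upper half suffice. -/
theorem IsSymmetricList.le_laplaceCost_even {t : ℕ} {b : Fin (2 * t + 2) → ℝ}
    (hb : IsSymmetricList b) {ε : ℝ} (hε : 0 < ε) :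
    ENNReal.ofReal (Real.log ((t + 2) / (t + 1)) / ε) ≤ laplaceCost (fun z => z) ε b := by
  rw [hb.laplaceCost_id_eq]
  set I := Finset.Ici (⟨t + 1, by omega⟩ : Fin (2 * t + 2)) with hI
  have hnn : ∀ i ∈ I, 0 ≤ b i := fun i hi => hb.nonneg i (by
    rw [hI, Finset.mem_Ici, Fin.le_def] at hi; simp only at hi; omega)
  have hcard : (I.image b).card ≤ t + 1 := by
    refine Finset.card_image_le.trans ?_
    rw [hI, Fin.card_Ici]
    simp only
    omega
  refine (le_expTail_infEDist_of_forall_le hε t (fun c S => le_expTail_infEDist hε t c S) 0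
    (S := I.image b) ⟨_, Finset.mem_image_of_mem b (Finset.mem_Ici.2 le_rfl)⟩ ?_ hcard).trans
    (expTail_mono fun x hx => infEDist_le_infEDist_of_forall_exists ?_)
  · intro y hy
    obtain ⟨i, hi, rfl⟩ := Finset.mem_image.1 hy
    exact hnn i hi
  · rintro _ ⟨i, rfl⟩
    by_cases hi : i ∈ I
    · exact ⟨b i, by exact_mod_cast Finset.mem_image_of_mem b hi, le_rfl⟩
    · have hr : i.rev ∈ I := by
        rw [hI, Finset.mem_Ici, Fin.le_def, Fin.val_rev]
        rw [hI, Finset.mem_Ici, Fin.le_def] at hi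
        simp only at hi ⊢
        omega
      refine ⟨b i.rev, by exact_mod_cast Finset.mem_image_of_mem b hr, ?_⟩
      have := hnn _ hr
      rw [hb.rev] at this ⊢
      rw [abs_of_nonneg (show 0 ≤ x - b i by linarith), abs_le]
      constructor <;> linarith

/-! ### The closed-form list and the optimal value. -/

theorem neg_closedFormRadius_mem {k : ℕ} (ε : ℝ) {j : ℕ} (h1 : 1 ≤ j) (h2 : 2 * j ≤ k + 1) :
    -closedFormRadius k ε j ∈ Set.range (closedFormPoint k ε) := by
  refine ⟨⟨j - 1, by omega⟩, ?_⟩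
  rw [closedFormPoint, if_pos (by simp only; omega)]
  simp only [Nat.sub_add_cancel h1]

theorem closedFormRadius_mem {k : ℕ} (ε : ℝ) {j : ℕ} (h1 : 1 ≤ j) (h2 : 2 * j ≤ k + 1) :
    closedFormRadius k ε j ∈ Set.range (closedFormPoint k ε) := by
  -- When `2 j = k + 1` the point is the centre of an odd list, entered only with a minus sign; its
  -- radius is `0`.
  rcases eq_or_lt_of_le h2 with h | h
  · have h0 : closedFormRadius k ε j = 0 := by
      have hodd : Odd k := ⟨j - 1, by omega⟩
      have hj : ((k : ℝ) + 1) / 2 = j := by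
        rw [div_eq_iff (by norm_num)]
        have : ((2 * j : ℕ) : ℝ) = ((k + 1 : ℕ) : ℝ) := by rw [h]
        push_cast at this
        linarith
      have hj0 : (j : ℝ) ≠ 0 := by exact_mod_cast (by omega : j ≠ 0)
      rw [closedFormRadius, if_pos hodd, hj, div_self hj0]
      simp
    have := neg_closedFormRadius_mem ε h1 h2
    rwa [h0, neg_zero, ← h0] at this
  · refine ⟨⟨k - j, by omega⟩, ?_⟩
    rw [closedFormPoint, if_neg (by simp only; omega)]
    simp only
    rw [show k - (k - j) = j by omega]

theorem closedFormRadius_odd (t : ℕ) (ε : ℝ) (j : ℕ) :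
    closedFormRadius (2 * t + 1) ε j = 2 * Real.log ((t + 1) / j) / ε := by
  rw [closedFormRadius, if_pos ⟨t, rfl⟩]
  congr 4
  push_cast
  ring

theorem closedFormRadius_even (t : ℕ) (ε : ℝ) (j : ℕ) :
    closedFormRadius (2 * t + 2) ε j =
      Real.log ((t + 1) * (t + 2) / (j : ℝ) ^ 2) / ε := by
  rw [closedFormRadius, if_neg (Nat.not_odd_iff_even.2 ⟨t + 1, by ring⟩)]
  congr 3
  push_cast
  ring

/-- Both halves of the closed-form list are bounded by a common half-line bound. -/
theorem laplaceCost_closedFormPoint_le {k : ℕ} {ε : ℝ} {l : ℝ≥0∞}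
    (H : ∀ S : Set ℝ, (∀ j : ℕ, 1 ≤ j → 2 * j ≤ k + 1 → closedFormRadius k ε j ∈ S) →
      (expTail ε 0 fun x => Metric.infEDist x S) ≤ l) :
    laplaceCost (fun z => z) ε (-closedFormPoint k ε) ≤ l := by
  rw [laplaceCost_id_eq, neg_neg]
  refine add_div_two_le (H _ fun j h1 h2 => ?_) (H _ fun j h1 h2 => closedFormRadius_mem ε h1 h2)
  obtain ⟨i, hi⟩ := neg_closedFormRadius_mem ε h1 h2
  exact ⟨i, by rw [Pi.neg_apply, hi, neg_neg]⟩

theorem exists_optimal_value {k : ℕ} (hk : 1 ≤ k) {ε : ℝ} (hε : 0 < ε) :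
    ∃ l : ℝ≥0∞, (∀ b : Fin k → ℝ, IsSymmetricList b → l ≤ laplaceCost (fun z => z) ε b) ∧
      laplaceCost (fun z => z) ε (-closedFormPoint k ε) ≤ l ∧
      l ≤ ENNReal.ofReal (2 / (ε * k)) := by
  rcases Nat.even_or_odd' k with ⟨t, rfl | rfl⟩
  · obtain ⟨t, rfl⟩ : ∃ s, t = s + 1 := ⟨t - 1, by omega⟩
    refine ⟨ENNReal.ofReal (Real.log ((t + 2) / (t + 1)) / ε),
      fun b hb => hb.le_laplaceCost_even hε, laplaceCost_closedFormPoint_le fun S hS => ?_,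
      ENNReal.ofReal_le_ofReal ?_⟩
    · refine expTail_infEDist_le_of_forall_le hε t
        (fun c S => expTail_infEDist_le hε t c S) fun j h1 h2 => ?_
      have := hS j h1 (by omega)
      rwa [show 2 * (t + 1) = 2 * t + 2 by ring, closedFormRadius_even, ← zero_add (_ / ε)]
        at this
    · have h1 := Real.log_le_sub_one_of_pos (show (0 : ℝ) < (t + 2) / (t + 1) by positivity)
      have h2 : ((t : ℝ) + 2) / (t + 1) - 1 = 1 / (t + 1) := by field_simp; ring
      rw [h2] at h1
      push_cast
      calc Real.log (((t : ℝ) + 2) / (t + 1)) / ε ≤ (1 / (t + 1)) / ε := by gcongr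
        _ = _ := by field_simp
  · refine ⟨ENNReal.ofReal (1 / ((t + 1) * ε)),
      fun b hb => hb.le_laplaceCost_odd hε, laplaceCost_closedFormPoint_le fun S hS => ?_,
      ENNReal.ofReal_le_ofReal ?_⟩
    · refine expTail_infEDist_le hε t 0 S fun j h1 h2 => ?_
      have := hS j h1 (by omega)
      rwa [closedFormRadius_odd, ← zero_add (_ / ε)] at this
    · rw [div_le_div_iff₀ (by positivity) (by positivity)]
      push_cast
      nlinarith

/-- The Laplace density is itself log-Lipschitz of rate `ε`, so a bound over symmetric lists extends
to all lists. -/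
theorem le_laplaceCost {h : ℝ → ℝ} (hc : ContinuousOn h (Set.Ici 0))
    (hm : MonotoneOn h (Set.Ici 0)) {ε : ℝ} (hε : 0 < ε) {k : ℕ} (hk : 0 < k) {l : ℝ≥0∞}
    (hl : ∀ b : Fin k → ℝ, IsSymmetricList b → l ≤ laplaceCost h ε b) (a : Fin k → ℝ) :
    l ≤ laplaceCost h ε a := by
  have := mul_lintegral_le_of_le_laplaceCost hc hm hε hk hl (isLogLipschitz_laplaceWeight hε) a
  rwa [lintegral_laplaceWeight hε, mul_one,
    ← lintegral_laplaceNoise ε (measurable_minDisutility_left hc a)] at this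

/-- For linear disutility the closed-form answers are optimal. -/
theorem optimalCost_id {g : ℝ≥0 → ℝ≥0∞} {ε : ℝ} (hg : IsPrivacyProfile g ε) {k : ℕ} (hk : 1 ≤ k) :
    mechanismCost (fun z => z) (laplaceAction ε) (shiftResponse (closedFormPoint k ε)) =
        optimalCost.{v} (fun z => z) g k ∧
      optimalCost.{v} (fun z => z) g k ≤ ENNReal.ofReal (2 / (ε * k)) := by
  have hc : ContinuousOn (fun z : ℝ => z) (Set.Ici 0) := continuousOn_id
  have hm : MonotoneOn (fun z : ℝ => z) (Set.Ici 0) := fun x _ y _ hxy => hxy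
  obtain ⟨l, hl, hcl, hl2⟩ := exists_optimal_value hk hg.deriv_pos
  obtain ⟨a, ha⟩ := exists_laplaceCost_eq_optimalCost.{v} hc hm hg hk
  have := isMarkovKernel_shiftResponse (closedFormPoint k ε)
  have hle := optimalCost_le_mechanismCost.{v} hc (isGeoPrivate_laplaceAction hg)
    (shiftResponse (closedFormPoint k ε))
  have hlow : l ≤ optimalCost.{v} (fun z => z) g k := by
    rw [← ha]
    exact le_laplaceCost hc hm hg.deriv_pos hk hl a
  rw [mechanismCost_laplaceAction hc] at hle ⊢
  exact ⟨le_antisymm (hcl.trans hlow) hle, hle.trans (hcl.trans hl2)⟩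

theorem theorem5 :
    -- Laplace noise of rate `g'(0)` is an optimal user action
    (∀ (h : ℝ → ℝ), IsDisutility h →
      ∀ (g : ℝ≥0 → ℝ≥0∞) (ε : ℝ), IsPrivacyProfile g ε → ∀ k : ℕ, 1 ≤ k →
        IsGeoPrivate g (laplaceAction ε) ∧
        ∃ Q : Kernel ℝ (Fin k → ℝ), IsMarkovKernel Q ∧
          mechanismCost h (laplaceAction ε) Q = optimalCost.{v} h g k) ∧
    -- for `h z = z` the optimal cost is `O(1 / (g'(0) k))`, with an absolute constant
    (∃ C : ℝ, 0 < C ∧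
      ∀ (g : ℝ≥0 → ℝ≥0∞) (ε : ℝ), IsPrivacyProfile g ε → ∀ k : ℕ, 1 ≤ k →
        optimalCost.{v} (fun z => z) g k ≤ ENNReal.ofReal (C / (ε * k))) ∧
    -- for `h z = z` an optimal mechanism in closed form
    (∀ (g : ℝ≥0 → ℝ≥0∞) (ε : ℝ), IsPrivacyProfile g ε → ∀ k : ℕ, 1 ≤ k →
      mechanismCost (fun z => z) (laplaceAction ε) (shiftResponse (closedFormPoint k ε)) =
        optimalCost.{v} (fun z => z) g k) := by
  refine ⟨fun h hh g ε hg k hk => ⟨isGeoPrivate_laplaceAction hg, ?_⟩,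
    ⟨2, two_pos, fun g ε hg k hk => (optimalCost_id hg hk).2⟩,
    fun g ε hg k hk => (optimalCost_id hg hk).1⟩
  obtain ⟨a, ha⟩ := exists_laplaceCost_eq_optimalCost.{v} hh.continuousOn hh.monotoneOn hg hk
  refine ⟨shiftResponse (-a), isMarkovKernel_shiftResponse _, ?_⟩
  rw [mechanismCost_laplaceAction hh.continuousOn, neg_neg, ha]
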